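/- For $0\le r\le 1$ and $0\le\theta\le\pi/2$ let $$W(r,\theta)=\frac{8}{\pi}\sum_{n=1}^{\infty}\frac{r^{m_n^2}}{(m_n^2-1)\,m_n}\sin(m_n\theta),\qquad m_n=4n-2,$$ and let $w$ be $W$ in Cartesian coordinates, $w(r\cos\theta,r\sin\theta)=W(r,\theta)$. Put $\Omega_1=(0,1)^2$, $\delta=\{(t,t): 0\le t\le 1\}$, $D_1=(0,1)\times(0,\pi/2)$ and $B_1=\{(p,q): p>0,\ q>0,\ p^2+q^2<1\}$. For $\mathbf x=(x,y)\in\Omega_1$ let $$f_{\mathbf x}(r,\theta)=r(x\cos\theta+y\sin\theta)-W(r,\theta),\qquad u(\mathbf x)=\min_{0\le\theta\le\pi/2}\ \max_{0\le r\le1} f_{\mathbf x}(r,\theta).$$ 1. For every $\mathbf x\in\Omega_1$ the minimax is attained at exactly one point $(r,\theta)\in[0,1]\times[0,\pi/2]$ (that is, $r$ maximizes $f_{\mathbf x}(\cdot,\theta)$ over $[0,1]$ and $\theta$ minimizes $\max_{0\le\rho\le1}f_{\mathbf x}(\rho,\cdot)$ over $[0,\pi/2]$), and this point lies in $D_1$.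 Hence $\mathbf g(\mathbf x):=(r\cos\theta,r\sin\theta)\in B_1$ is well defined, and $u(\mathbf x)=\mathbf x\cdot\mathbf g(\mathbf x)-w(\mathbf g(\mathbf x))$ for all $\mathbf x\in\Omega_1$. 2. The functions $\mathbf g$ and $u$ are real-analytic in $\Omega_1\setminus\delta$. 3. There $u$ is $\infty$-harmonic in the classical sense: writing $\nabla u$ for the gradient (as a row vector) and $\mathcal Hu$ for the Hessian matrix, $$\Delta_\infty u=\nabla u\,\mathcal Hu\,\nabla u^{\top}=0\qquad\text{at every point of }\Omega_1\setminus\delta.$$ 4. The function $w$ is real-analytic in $B_1$, its Hessian matrix is nonsingular at every $(p,q)\in B_1$ with $p\ne q$ (that is, off $\theta=\pi/4$), and $p^2w_{qq}-2pq\,w_{pq}+q^2w_{pp}=0$ in $B_1$. -/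

import Mathlib

/-! Points of the plane are written as vectors `Fin 2 → ℝ`, so that gradients and Hessian
matrices can be multiplied with Mathlib's `⬝ᵥ` and `*ᵥ`.  No norm on the plane is used below:
analyticity and partial derivatives do not depend on the choice of a norm. -/

namespace InfinityPotential

open Set
open scoped Matrix

noncomputable section

/-- `W(r, θ) = (8/π) ∑_{n ≥ 1} r^(m_n²) sin(m_n θ) / ((m_n² - 1) m_n)`, with `m_n = 4 n - 2`.
The summation index is shifted by one, so that `m = 4 n + 2` for `n = 0, 1, 2, …`. -/
def W (r θ : ℝ) : ℝ :=
  8 / Real.pi * ∑' n : ℕ,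
    r ^ ((4 * n + 2) ^ 2) / ((((4 * n + 2 : ℕ) : ℝ) ^ 2 - 1) * ((4 * n + 2 : ℕ) : ℝ)) *
      Real.sin (((4 * n + 2 : ℕ) : ℝ) * θ)

/-- The open square `0 < x < 1`, `0 < y < 1`. -/
def Omega1 : Set (Fin 2 → ℝ) :=
  {x | 0 < x 0 ∧ x 0 < 1 ∧ 0 < x 1 ∧ x 1 < 1}

/-- The diagonal of the closed unit square. -/
def diagonal : Set (Fin 2 → ℝ) :=
  {x | ∃ t ∈ Icc (0 : ℝ) 1, x = ![t, t]}

/-- The open rectangle `0 < r < 1`, `0 < θ < π/2` of polar coordinates. -/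
def D1 : Set (ℝ × ℝ) := Ioo 0 1 ×ˢ Ioo 0 (Real.pi / 2)

/-- The open circular sector in the first quadrant. -/
def B1 : Set (Fin 2 → ℝ) :=
  {p | 0 < p 0 ∧ 0 < p 1 ∧ p 0 ^ 2 + p 1 ^ 2 < 1}

/-- The polar coordinate map. -/
def polarMap (ρ : ℝ × ℝ) : Fin 2 → ℝ :=
  ![ρ.1 * Real.cos ρ.2, ρ.1 * Real.sin ρ.2]

/-- `W` in Cartesian coordinates: `w(r cos θ, r sin θ) = W(r, θ)`. -/
def w (p : Fin 2 → ℝ) : ℝ :=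
  W (Real.sqrt (p 0 ^ 2 + p 1 ^ 2)) (Complex.arg ⟨p 0, p 1⟩)

/-- The objective function `f_x(r, θ) = r (x cos θ + y sin θ) - W(r, θ)`. -/
def objective (x : Fin 2 → ℝ) (r θ : ℝ) : ℝ :=
  r * (x 0 * Real.cos θ + x 1 * Real.sin θ) - W r θ

/-- The maximum of the objective function over `0 ≤ r ≤ 1`, for a fixed angle `θ`. -/
def maxOverRadius (x : Fin 2 → ℝ) (θ : ℝ) : ℝ :=
  ⨆ r : Icc (0 : ℝ) 1, objective x r θ

/-- `u(x) = min_{0 ≤ θ ≤ π/2} max_{0 ≤ r ≤ 1} f_x(r, θ)`. -/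
def u (x : Fin 2 → ℝ) : ℝ :=
  ⨅ θ : Icc (0 : ℝ) (Real.pi / 2), maxOverRadius x θ

/-- `ρ = (r, θ)` is a point of the closed rectangle at which the minimax is attained: `r` maximizes
`f_x(·, θ)`, and `θ` minimizes that maximum. -/
def IsMinimax (x : Fin 2 → ℝ) (ρ : ℝ × ℝ) : Prop :=
  ρ.1 ∈ Icc (0 : ℝ) 1 ∧ ρ.2 ∈ Icc (0 : ℝ) (Real.pi / 2) ∧
    IsMaxOn (fun r => objective x r ρ.2) (Icc 0 1) ρ.1 ∧
    IsMinOn (maxOverRadius x) (Icc 0 (Real.pi / 2)) ρ.2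

/-- The point at which the minimax is attained. -/
def minimaxPoint (x : Fin 2 → ℝ) : ℝ × ℝ :=
  Classical.epsilon (IsMinimax x)

/-- `g(x) = (r cos θ, r sin θ)`, where `(r, θ)` is the minimax point. -/
def g (x : Fin 2 → ℝ) : Fin 2 → ℝ :=
  polarMap (minimaxPoint x)

/-- The partial derivative of `v` in the `i`-th coordinate direction. -/
def partialDeriv (i : Fin 2) (v : (Fin 2 → ℝ) → ℝ) (x : Fin 2 → ℝ) : ℝ :=
  fderiv ℝ v x (Pi.single i 1)

/-- The gradient of `v`. -/
def grad (v : (Fin 2 → ℝ) → ℝ) (x : Fin 2 → ℝ) : Fin 2 → ℝ :=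
  fun i => partialDeriv i v x

/-- The Hessian matrix of `v`. -/
def hessian (v : (Fin 2 → ℝ) → ℝ) (x : Fin 2 → ℝ) : Matrix (Fin 2) (Fin 2) ℝ :=
  Matrix.of fun i j => partialDeriv i (partialDeriv j v) x

/-- The infinity-Laplacian `Δ_∞ v = ∇v · Hv · ∇vᵀ`. -/
def infLaplacian (v : (Fin 2 → ℝ) → ℝ) (x : Fin 2 → ℝ) : ℝ :=
  grad v x ⬝ᵥ (hessian v x *ᵥ grad v x)

end

end InfinityPotential

open scoped Matrix
open InfinityPotential (Omega1 B1 D1 diagonal w u g objective IsMinimax minimaxPoint hessian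
  infLaplacian)

/-!
The series `W` solves `W_θθ + r W_r = 0`, which is the heat equation in the time `t = -log r`, with
zero values at `θ = 0` and `θ = π / 2` and initial values `W(1, θ) = cos θ + sin θ - 1`. In
Cartesian coordinates this equation is the linear hodograph equation for `w`. All derivatives of
`W` are again sums of the form `trigSeries`, and everything rests on two sign properties:

* `W_rr > 0` in the open rectangle (`Wrr_pos`). Up to a factor, `r ^ 2 W_rr` is the sum
  `∑ m r ^ (m ^ 2) sin (m θ)`. Its regularization with coefficients `m σ ^ m`, `σ < 1`, has
  nonnegative initial values, by an explicit summation, so the minimum principle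
  `nonneg_of_heat_supersolution` and `σ → 1` give a nonnegative sum; comparison with an explicit
  subsolution makes it positive (`trigSeries_freq_pos`).
* `r W_rθ - W_θ ≠ 0` for `θ ≠ π / 4` (`mul_Wrt_sub_Wt_ne_zero`). Up to a factor this is the sum
  `∑ r ^ (m ^ 2) cos (m θ)`, whose derivative in `θ` is minus the sum above and which vanishes at
  `θ = π / 4`.

For fixed `θ` in `(0, π / 2)` the maximum over `r` is attained at an interior radius, the unique
zero of `f_r`; the value `r = 1` is excluded by the barrier estimate `W_le_of_half_le`. By the
implicit function theorem the maximum `M(θ)` is twice differentiable, with `M' = f_θ` at the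
maximizing radius. Since `f_θθ = -r f_r` vanishes there, `M'' = (f_rθ) ^ 2 / W_rr ≥ 0`, and where
`M' = 0` the number `f_rθ` is `-(r W_rθ - W_θ) / r`. Hence `M'` has at most one zero
(`envelopeDeriv_zero_unique`). As `M` does not attain its minimum at the end points, because
`W_θ(1, 0) = 1`, minimax points and critical points of `f` in the open rectangle are the same
thing, and there is exactly one.

In terms of `p = (r cos θ, r sin θ)` a point is critical for `f_x` exactly when `∇w(p) = x`, so `g`
is the inverse of `∇w`. In the frame `p, p^⊥` the Hessian matrix of `w` has entries `r W_rθ - W_θ`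
off the diagonal and `W_θθ + r W_r = 0` in one diagonal place, so it is nonsingular off
`θ = π / 4`, and the inverse function theorem makes `g` analytic. Finally `u = x ⬝ g - w(g)` gives
`∇u = g`, the Hessian matrix of `u` is the inverse of that of `w`, and `Δ_∞ u` is a multiple of the
left-hand side of the hodograph equation.
-/

namespace InfinityPotential

open Set Filter Topology Asymptotics
open scoped ContDiff

noncomputable section

/-! ### Trigonometric series with frequencies `4 n + 2` -/

/-- The frequencies `2, 6, 10, …` of the series `W`. -/
def freq (n : ℕ) : ℕ := 4 * n + 2

/-- The series `∑ c_n r ^ (m_n ^ 2 - k) sin (m_n θ + α)`. The shift `k` of the exponent keeps track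
of derivatives in `r`, and the phase `α` of derivatives in `θ`: a cosine series is the case
`α = π / 2`. -/
def trigSeries (c : ℕ → ℝ) (k : ℕ) (α r θ : ℝ) : ℝ :=
  ∑' n : ℕ, c n * r ^ (freq n ^ 2 - k) * Real.sin (freq n * θ + α)

/-- Polynomial growth of a sequence of coefficients. -/
def PolyGrowth (c : ℕ → ℝ) : Prop := ∃ N : ℕ, c =O[atTop] fun n => (n : ℝ) ^ N

lemma PolyGrowth.mul {c d : ℕ → ℝ} (hc : PolyGrowth c) (hd : PolyGrowth d) :
    PolyGrowth fun n => c n * d n := by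
  obtain ⟨N, hN⟩ := hc
  obtain ⟨M, hM⟩ := hd
  exact ⟨N + M, by simpa only [pow_add] using hN.mul hM⟩

lemma PolyGrowth.of_abs_le_one {c : ℕ → ℝ} (hc : ∀ n, |c n| ≤ 1) : PolyGrowth c :=
  ⟨0, IsBigO.of_bound 1 (Eventually.of_forall fun n => by simpa using hc n)⟩

lemma polyGrowth_freq : PolyGrowth fun n => (freq n : ℝ) := by
  refine ⟨1, IsBigO.of_bound 6 ?_⟩
  filter_upwards [eventually_ge_atTop 1] with n hn
  have hn' : (1 : ℝ) ≤ n := by exact_mod_cast hn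
  simp only [freq, Real.norm_eq_abs, pow_one, Nat.abs_cast]
  push_cast
  linarith

lemma polyGrowth_freq_sq_sub (k : ℕ) : PolyGrowth fun n => ((freq n ^ 2 - k : ℕ) : ℝ) := by
  obtain ⟨N, hN⟩ := polyGrowth_freq.mul polyGrowth_freq
  refine ⟨N, IsBigO.trans (IsBigO.of_bound 1 (Eventually.of_forall fun n => ?_)) hN⟩
  have : freq n ^ 2 - k ≤ freq n * freq n := by rw [sq]; exact Nat.sub_le _ _
  have h2 : ((freq n ^ 2 - k : ℕ) : ℝ) ≤ freq n * freq n := by exact_mod_cast this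
  rw [one_mul, Real.norm_of_nonneg (by positivity), Real.norm_of_nonneg (by positivity)]
  exact h2

lemma PolyGrowth.summable {c : ℕ → ℝ} (hc : PolyGrowth c) {ρ : ℝ} (h0 : 0 ≤ ρ) (h1 : ρ < 1) :
    Summable fun n => |c n| * ρ ^ n := by
  obtain ⟨N, hN⟩ := hc
  refine summable_of_isBigO_nat (summable_pow_mul_geometric_of_norm_lt_one (r := ρ) N ?_)
    (hN.norm_left.mul (isBigO_refl _ _))
  rwa [Real.norm_of_nonneg h0]

lemma le_freq_sq_sub {k : ℕ} (hk : k ≤ 3) (n : ℕ) : n ≤ freq n ^ 2 - k := by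
  have : n + 3 ≤ freq n ^ 2 := by unfold freq; nlinarith
  omega

lemma abs_pow_freq_le {k : ℕ} (hk : k ≤ 3) {r ρ : ℝ} (hr : |r| ≤ ρ) (h1 : ρ < 1) (n : ℕ) :
    |r ^ (freq n ^ 2 - k)| ≤ ρ ^ n := by
  have h0 : 0 ≤ ρ := (abs_nonneg r).trans hr
  rw [abs_pow]
  exact (pow_le_pow_left₀ (abs_nonneg r) hr _).trans
    (pow_le_pow_of_le_one h0 h1.le (le_freq_sq_sub hk n))

lemma norm_trigSeries_term_le {c : ℕ → ℝ} {k : ℕ} (hk : k ≤ 3) {r ρ : ℝ} (hr : |r| ≤ ρ)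
    (h1 : ρ < 1) (α θ : ℝ) (n : ℕ) :
    ‖c n * r ^ (freq n ^ 2 - k) * Real.sin (freq n * θ + α)‖ ≤ |c n| * ρ ^ n := by
  rw [Real.norm_eq_abs, abs_mul, abs_mul]
  have h0 : 0 ≤ ρ := (abs_nonneg r).trans hr
  calc |c n| * |r ^ (freq n ^ 2 - k)| * |Real.sin (freq n * θ + α)|
      ≤ |c n| * ρ ^ n * 1 := by
        gcongr
        · exact abs_pow_freq_le hk hr h1 n
        · exact Real.abs_sin_le_one _
    _ = _ := mul_one _

lemma summable_trigSeries {c : ℕ → ℝ} (hc : PolyGrowth c) {k : ℕ} (hk : k ≤ 3) {r : ℝ}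
    (hr : |r| < 1) (α θ : ℝ) :
    Summable fun n => c n * r ^ (freq n ^ 2 - k) * Real.sin (freq n * θ + α) :=
  Summable.of_norm_bounded (hc.summable (abs_nonneg r) hr)
    (norm_trigSeries_term_le hk le_rfl hr α θ)

/-- Termwise differentiation of a trigonometric series in both variables. -/
lemma hasFDerivAt_trigSeries {c : ℕ → ℝ} (hc : PolyGrowth c) {k : ℕ} (hk : k ≤ 2) (α : ℝ)
    {r : ℝ} (hr : |r| < 1) (θ : ℝ) :
    HasFDerivAt (fun p : ℝ × ℝ => trigSeries c k α p.1 p.2)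
      (trigSeries (fun n => c n * ((freq n ^ 2 - k : ℕ) : ℝ)) (k + 1) α r θ •
          ContinuousLinearMap.fst ℝ ℝ ℝ +
        trigSeries (fun n => c n * freq n) k (α + Real.pi / 2) r θ •
          ContinuousLinearMap.snd ℝ ℝ ℝ) (r, θ) := by
  obtain ⟨ρ, hρ, hρ1⟩ := exists_between hr
  have hρ0 : 0 ≤ ρ := (abs_nonneg r).trans hρ.le
  have hc1 := hc.mul (polyGrowth_freq_sq_sub k)
  have hc2 := hc.mul polyGrowth_freq
  set A : ℕ → ℝ × ℝ → ℝ := fun n p =>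
    c n * ((freq n ^ 2 - k : ℕ) : ℝ) * p.1 ^ (freq n ^ 2 - (k + 1)) *
      Real.sin (freq n * p.2 + α) with hA
  set B : ℕ → ℝ × ℝ → ℝ := fun n p =>
    c n * freq n * p.1 ^ (freq n ^ 2 - k) * Real.sin (freq n * p.2 + (α + Real.pi / 2)) with hB
  have key := hasFDerivAt_tsum_of_isPreconnected
    (f := fun n (p : ℝ × ℝ) => c n * p.1 ^ (freq n ^ 2 - k) * Real.sin (freq n * p.2 + α))
    (f' := fun n p => A n p • ContinuousLinearMap.fst ℝ ℝ ℝ + B n p •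
      ContinuousLinearMap.snd ℝ ℝ ℝ)
    (u := fun n => |c n * ((freq n ^ 2 - k : ℕ) : ℝ)| * ρ ^ n + |c n * freq n| * ρ ^ n)
    (s := Ioo (-ρ) ρ ×ˢ univ) (x₀ := (r, θ)) (x := (r, θ)) ?_ ?_ ?_ ?_ ?_ ?_ ?_ ?_
  · convert! key using 1
    rw [Summable.tsum_add, Summable.tsum_smul_const, Summable.tsum_smul_const]
    · rfl
    · exact summable_trigSeries hc2 (by omega) hr _ _
    · exact summable_trigSeries hc1 (by omega) hr _ _
    · exact (summable_trigSeries hc1 (by omega) hr _ _).smul_const _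
    · exact (summable_trigSeries hc2 (by omega) hr _ _).smul_const _
  · exact (hc1.summable hρ0 hρ1).add (hc2.summable hρ0 hρ1)
  · exact isOpen_Ioo.prod isOpen_univ
  · exact ((convex_Ioo _ _).prod convex_univ).isPreconnected
  · rintro n p -
    have e1 : HasFDerivAt (fun p : ℝ × ℝ => p.1) (ContinuousLinearMap.fst ℝ ℝ ℝ) p :=
      hasFDerivAt_fst
    have e2 : HasFDerivAt (fun p : ℝ × ℝ => p.2) (ContinuousLinearMap.snd ℝ ℝ ℝ) p :=
      hasFDerivAt_snd
    have h := ((e1.pow (freq n ^ 2 - k)).const_mul (c n)).mul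
      (((e2.const_mul (freq n : ℝ)).add_const α).sin)
    convert! h using 1
    have hs : Real.sin (freq n * p.2 + (α + Real.pi / 2)) = Real.cos (freq n * p.2 + α) := by
      rw [← add_assoc, Real.sin_add_pi_div_two]
    ext <;> simp [hA, hB, hs, Nat.sub_sub] <;> ring
  · rintro n ⟨a, b⟩ hp
    have ha : |a| ≤ ρ := (abs_lt.2 hp.1).le
    refine (norm_add_le _ _).trans (add_le_add ?_ ?_)
    · rw [norm_smul]
      refine (mul_le_mul_of_nonneg_left (ContinuousLinearMap.norm_fst_le ..)
        (norm_nonneg _)).trans ?_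
      rw [mul_one]
      exact norm_trigSeries_term_le (c := fun n => c n * ((freq n ^ 2 - k : ℕ) : ℝ))
        (k := k + 1) (by omega) ha hρ1 α b n
    · rw [norm_smul]
      refine (mul_le_mul_of_nonneg_left (ContinuousLinearMap.norm_snd_le ..)
        (norm_nonneg _)).trans ?_
      rw [mul_one]
      exact norm_trigSeries_term_le (c := fun n => c n * freq n)
        (k := k) (by omega) ha hρ1 (α + Real.pi / 2) b n
  · exact ⟨abs_lt.1 hρ, mem_univ _⟩
  · exact summable_trigSeries hc (by omega) hr _ _
  · exact ⟨abs_lt.1 hρ, mem_univ _⟩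

lemma continuousAt_trigSeries {c : ℕ → ℝ} (hc : PolyGrowth c) {k : ℕ} (hk : k ≤ 2) (α : ℝ)
    {r : ℝ} (hr : |r| < 1) (θ : ℝ) :
    ContinuousAt (fun p : ℝ × ℝ => trigSeries c k α p.1 p.2) (r, θ) :=
  (hasFDerivAt_trigSeries hc hk α hr θ).continuousAt

lemma hasStrictFDerivAt_trigSeries {c : ℕ → ℝ} (hc : PolyGrowth c) {k : ℕ} (hk : k ≤ 1) (α : ℝ)
    {r : ℝ} (hr : |r| < 1) (θ : ℝ) :
    HasStrictFDerivAt (fun p : ℝ × ℝ => trigSeries c k α p.1 p.2)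
      (trigSeries (fun n => c n * ((freq n ^ 2 - k : ℕ) : ℝ)) (k + 1) α r θ •
          ContinuousLinearMap.fst ℝ ℝ ℝ +
        trigSeries (fun n => c n * freq n) k (α + Real.pi / 2) r θ •
          ContinuousLinearMap.snd ℝ ℝ ℝ) (r, θ) := by
  refine hasStrictFDerivAt_of_hasFDerivAt_of_continuousAt (x := (r, θ))
    (f := fun p : ℝ × ℝ => trigSeries c k α p.1 p.2)
    (f' := fun p : ℝ × ℝ =>
      trigSeries (fun n => c n * ((freq n ^ 2 - k : ℕ) : ℝ)) (k + 1) α p.1 p.2 •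
          ContinuousLinearMap.fst ℝ ℝ ℝ +
        trigSeries (fun n => c n * freq n) k (α + Real.pi / 2) p.1 p.2 •
          ContinuousLinearMap.snd ℝ ℝ ℝ) ?_ ?_
  · have : ∀ᶠ p : ℝ × ℝ in 𝓝 (r, θ), |p.1| < 1 :=
      (continuous_fst.abs.continuousAt (x := ((r, θ) : ℝ × ℝ))).eventually_lt continuousAt_const hr
    filter_upwards [this] with p hp
    exact hasFDerivAt_trigSeries hc (by omega) α hp p.2
  · exact ((continuousAt_trigSeries (hc.mul (polyGrowth_freq_sq_sub k)) (by omega) α hr θ).smul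
      continuousAt_const).add
      ((continuousAt_trigSeries (hc.mul polyGrowth_freq) (by omega) _ hr θ).smul
      continuousAt_const)

lemma hasDerivAt_trigSeries_radius {c : ℕ → ℝ} (hc : PolyGrowth c) {k : ℕ} (hk : k ≤ 2) (α : ℝ)
    {r : ℝ} (hr : |r| < 1) (θ : ℝ) :
    HasDerivAt (fun s => trigSeries c k α s θ)
      (trigSeries (fun n => c n * ((freq n ^ 2 - k : ℕ) : ℝ)) (k + 1) α r θ) r := by
  have h := (hasFDerivAt_trigSeries hc hk α hr θ).comp_hasDerivAt r
    ((hasDerivAt_id r).prodMk (hasDerivAt_const r θ))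
  simpa using! h

lemma hasDerivAt_trigSeries_angle {c : ℕ → ℝ} (hc : PolyGrowth c) {k : ℕ} (hk : k ≤ 2) (α : ℝ)
    {r : ℝ} (hr : |r| < 1) (θ : ℝ) :
    HasDerivAt (fun s => trigSeries c k α r s)
      (trigSeries (fun n => c n * freq n) k (α + Real.pi / 2) r θ) θ := by
  have h := (hasFDerivAt_trigSeries hc hk α hr θ).comp_hasDerivAt θ
    ((hasDerivAt_const θ r).prodMk (hasDerivAt_id θ))
  simpa using! h

lemma mul_trigSeries_succ (c : ℕ → ℝ) {k : ℕ} (hk : k ≤ 2) (α r θ : ℝ) :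
    r * trigSeries c (k + 1) α r θ = trigSeries c k α r θ := by
  unfold trigSeries
  rw [← tsum_mul_left]
  congr 1 with n
  have := le_freq_sq_sub (k := k + 1) (by omega) n
  have h4 : 4 ≤ freq n ^ 2 := by unfold freq; nlinarith [Nat.zero_le n]
  have e : freq n ^ 2 - k = freq n ^ 2 - (k + 1) + 1 := by omega
  rw [e, pow_succ]
  ring

lemma trigSeries_add_pi (c : ℕ → ℝ) (k : ℕ) (α r θ : ℝ) :
    trigSeries c k (α + Real.pi) r θ = -trigSeries c k α r θ := by
  unfold trigSeries
  rw [← tsum_neg]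
  congr 1 with n
  rw [← add_assoc, Real.sin_add_pi]
  ring

lemma trigSeries_half_add_half (c : ℕ → ℝ) (k : ℕ) (r θ : ℝ) :
    trigSeries c k (0 + Real.pi / 2 + Real.pi / 2) r θ = -trigSeries c k 0 r θ := by
  rw [← trigSeries_add_pi]
  congr 1
  ring

/-- With summable coefficients the series converges uniformly up to `r = 1`. -/
lemma continuousOn_trigSeries {c : ℕ → ℝ} (hc : Summable fun n => |c n|) (α : ℝ) :
    ContinuousOn (fun p : ℝ × ℝ => trigSeries c 0 α p.1 p.2) (Icc 0 1 ×ˢ univ) := by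
  refine continuousOn_tsum (fun n => by fun_prop) hc ?_
  rintro n ⟨r, θ⟩ ⟨hr, -⟩
  rw [Real.norm_eq_abs, abs_mul, abs_mul]
  calc |c n| * |r ^ (freq n ^ 2 - 0)| * |Real.sin (freq n * θ + α)| ≤ |c n| * 1 * 1 := by
        gcongr
        · rw [abs_pow, abs_of_nonneg hr.1]
          exact pow_le_one₀ hr.1 hr.2
        · exact Real.abs_sin_le_one _
    _ = _ := by ring

lemma sin_freq_mul_pi_div_two (n : ℕ) : Real.sin (freq n * (Real.pi / 2)) = 0 := by
  have : (freq n : ℝ) * (Real.pi / 2) = ((2 * n + 1 : ℕ) : ℝ) * Real.pi := by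
    simp only [freq]; push_cast; ring
  rw [this, Real.sin_nat_mul_pi]

lemma cos_freq_mul_pi_div_two (n : ℕ) : Real.cos (freq n * (Real.pi / 2)) = -1 := by
  have : (freq n : ℝ) * (Real.pi / 2) = (n : ℝ) * (2 * Real.pi) + Real.pi := by
    simp only [freq]; push_cast; ring
  rw [this, Real.cos_nat_mul_two_pi_add_pi]

lemma trigSeries_zero_angle (c : ℕ → ℝ) (k : ℕ) (r : ℝ) : trigSeries c k 0 r 0 = 0 := by
  simp [trigSeries]

lemma trigSeries_pi_div_two (c : ℕ → ℝ) (k : ℕ) (r : ℝ) :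
    trigSeries c k 0 r (Real.pi / 2) = 0 := by
  simp [trigSeries, sin_freq_mul_pi_div_two]

lemma trigSeries_pi_div_four (c : ℕ → ℝ) (k : ℕ) (r : ℝ) :
    trigSeries c k (Real.pi / 2) r (Real.pi / 4) = 0 := by
  have hz (n : ℕ) : Real.sin (freq n * (Real.pi / 4) + Real.pi / 2) = 0 := by
    have : (freq n : ℝ) * (Real.pi / 4) + Real.pi / 2 = ((n + 1 : ℕ) : ℝ) * Real.pi := by
      simp only [freq]; push_cast; ring
    rw [this, Real.sin_nat_mul_pi]
  simp [trigSeries, hz]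

/-- The reflection `θ ↦ π / 2 - θ` is a symmetry of the sine series. -/
lemma trigSeries_reflect (c : ℕ → ℝ) (k : ℕ) (r θ : ℝ) :
    trigSeries c k 0 r (Real.pi / 2 - θ) = trigSeries c k 0 r θ := by
  unfold trigSeries
  congr 1 with n
  rw [add_zero, add_zero, mul_sub, Real.sin_sub, sin_freq_mul_pi_div_two,
    cos_freq_mul_pi_div_two]
  ring

lemma trigSeries_zero_radius (c : ℕ → ℝ) {k : ℕ} (hk : k ≤ 3) (α θ : ℝ) :
    trigSeries c k α 0 θ = 0 := by
  have h (n : ℕ) : freq n ^ 2 - k ≠ 0 := by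
    have h4 : 4 ≤ freq n ^ 2 := by unfold freq; nlinarith [Nat.zero_le n]
    omega
  simp [trigSeries, zero_pow (h _)]

lemma two_le_freq (n : ℕ) : (2 : ℝ) ≤ freq n := by
  simp only [freq]; push_cast; nlinarith [Nat.cast_nonneg (α := ℝ) n]

/-! ### The maximum principle for the heat equation `h_θθ + r h_r = 0` -/

lemma deriv_deriv_nonneg_of_isLocalMin {f f' : ℝ → ℝ} {x d : ℝ} (h : IsLocalMin f x)
    (h1 : ∀ᶠ y in 𝓝 x, HasDerivAt f (f' y) y) (h2 : HasDerivAt f' d x) : 0 ≤ d := by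
  by_contra hd
  push Not at hd
  have e : deriv f =ᶠ[𝓝 x] f' := h1.mono fun y hy => hy.deriv
  have hd2 : deriv (deriv f) x = d := by rw [e.deriv_eq, h2.deriv]
  have hmax : IsLocalMax f x := isLocalMax_of_deriv_deriv_neg (by rw [hd2]; exact hd)
    h.deriv_eq_zero h1.self_of_nhds.continuousAt
  have hconst : f =ᶠ[𝓝 x] fun _ => f x := by
    filter_upwards [h, hmax] with y hy1 hy2
    exact le_antisymm hy2 hy1
  have h0 : deriv f =ᶠ[𝓝 x] fun _ => 0 := by
    filter_upwards [hconst.eventuallyEq_nhds] with y hy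
    rw [hy.deriv_eq, deriv_const]
  rw [h0.deriv_eq, deriv_const] at hd2
  exact hd.ne hd2.symm

/-- Weak minimum principle: with `t = -log r` the hypothesis on the derivatives reads
`h_t ≥ h_θθ`, and `r = r₁` is the initial time. -/
lemma nonneg_of_heat_supersolution {h hr hθ hθθ : ℝ → ℝ → ℝ} {r₀ r₁ a b : ℝ} (hr0 : 0 < r₀)
    (hcont : ContinuousOn (fun p : ℝ × ℝ => h p.1 p.2) (Icc r₀ r₁ ×ˢ Icc a b))
    (d1 : ∀ r ∈ Ico r₀ r₁, ∀ θ ∈ Ioo a b, HasDerivAt (fun s => h s θ) (hr r θ) r)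
    (d2 : ∀ r ∈ Ico r₀ r₁, ∀ θ ∈ Ioo a b, HasDerivAt (fun s => h r s) (hθ r θ) θ)
    (d3 : ∀ r ∈ Ico r₀ r₁, ∀ θ ∈ Ioo a b, HasDerivAt (fun s => hθ r s) (hθθ r θ) θ)
    (pde : ∀ r ∈ Ico r₀ r₁, ∀ θ ∈ Ioo a b, r * hr r θ + hθθ r θ ≤ 0)
    (htop : ∀ θ ∈ Icc a b, 0 ≤ h r₁ θ) (hleft : ∀ r ∈ Icc r₀ r₁, 0 ≤ h r a)
    (hright : ∀ r ∈ Icc r₀ r₁, 0 ≤ h r b) :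
    ∀ r ∈ Icc r₀ r₁, ∀ θ ∈ Icc a b, 0 ≤ h r θ := by
  intro r' hr' θ' hθ'
  by_contra hneg
  push Not at hneg
  -- the perturbation `ε (r₁ - r)` makes the differential inequality strict
  obtain ⟨ε, hε, hε'⟩ : ∃ ε > 0, h r' θ' + ε * (r₁ - r') < 0 := by
    refine ⟨-h r' θ' / (2 * (r₁ - r' + 1)), ?_, ?_⟩
    · have : 0 < r₁ - r' + 1 := by linarith [hr'.2]
      have : 0 < -h r' θ' := by linarith
      positivity
    · have h1 : 0 < r₁ - r' + 1 := by linarith [hr'.2]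
      have : -h r' θ' / (2 * (r₁ - r' + 1)) * (r₁ - r') =
        -h r' θ' / 2 * ((r₁ - r') / (r₁ - r' + 1)) := by field_simp
      rw [this]
      have h2 : (r₁ - r') / (r₁ - r' + 1) ≤ 1 := by rw [div_le_one h1]; linarith
      nlinarith
  have hc' : ContinuousOn (fun p : ℝ × ℝ => h p.1 p.2 + ε * (r₁ - p.1)) (Icc r₀ r₁ ×ˢ Icc a b) :=
    hcont.add (by fun_prop)
  obtain ⟨⟨r, θ⟩, ⟨hr1, hθ1⟩, hmin⟩ := (isCompact_Icc.prod isCompact_Icc).exists_isMinOn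
    ⟨(r', θ'), hr', hθ'⟩ hc'
  simp only at hr1 hθ1
  have hval : h r θ + ε * (r₁ - r) < 0 := by
    have := hmin (show (r', θ') ∈ Icc r₀ r₁ ×ˢ Icc a b from ⟨hr', hθ'⟩)
    exact lt_of_le_of_lt this hε'
  have hlt : h r θ < 0 := by nlinarith [hr1.2]
  have hrI : r ∈ Ico r₀ r₁ := by
    refine ⟨hr1.1, lt_of_le_of_ne hr1.2 ?_⟩
    rintro rfl
    exact absurd (htop θ hθ1) (not_le.2 hlt)
  have hθI : θ ∈ Ioo a b := by
    refine ⟨lt_of_le_of_ne hθ1.1 ?_, lt_of_le_of_ne hθ1.2 ?_⟩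
    · rintro rfl
      exact absurd (hleft r hr1) (not_le.2 hlt)
    · rintro rfl
      exact absurd (hright r hr1) (not_le.2 hlt)
  have hsec : 0 ≤ hθθ r θ := by
    refine deriv_deriv_nonneg_of_isLocalMin (f := fun s => h r s) (f' := fun s => hθ r s) ?_ ?_
      (d3 r hrI θ hθI)
    · filter_upwards [Ioo_mem_nhds hθI.1 hθI.2] with s hs
      have := hmin (show (r, s) ∈ Icc r₀ r₁ ×ˢ Icc a b from ⟨hr1, Ioo_subset_Icc_self hs⟩)
      simp only [mem_ofPred_eq] at this
      linarith
    · filter_upwards [Ioo_mem_nhds hθI.1 hθI.2] with s hs using d2 r hrI s hs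
  have hfirst : ε ≤ hr r θ := by
    have hd : HasDerivWithinAt (fun s => h s θ) (hr r θ) (Ioi r) r :=
      (d1 r hrI θ hθI).hasDerivWithinAt
    rw [hasDerivWithinAt_iff_tendsto_slope' self_notMem_Ioi] at hd
    refine ge_of_tendsto hd ?_
    filter_upwards [Ioo_mem_nhdsGT hrI.2] with s hs
    have := hmin (show (s, θ) ∈ Icc r₀ r₁ ×ˢ Icc a b from ⟨⟨hr1.1.trans hs.1.le, hs.2.le⟩, hθ1⟩)
    simp only [mem_ofPred_eq] at this
    rw [slope_def_field, le_div_iff₀ (by linarith [hs.1])]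
    linarith
  have := pde r hrI θ hθI
  have hrpos : 0 < r := hr0.trans_le hr1.1
  nlinarith [mul_pos hrpos hε, mul_le_mul_of_nonneg_left hfirst hrpos.le]

/-! ### Positivity of `∑ m r ^ (m ^ 2) sin (m θ)` -/

/-- The imaginary part of `z / (1 - z) ^ 2`, up to a factor the angular derivative of the Poisson
kernel, is nonnegative in the upper half of the unit disc. -/
lemma im_div_one_sub_sq_nonneg {z : ℂ} (h0 : 0 ≤ z.im) (h1 : ‖z‖ < 1) :
    0 ≤ (z / (1 - z) ^ 2).im := by
  have hz : z.re ^ 2 + z.im ^ 2 < 1 := by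
    have := Complex.sq_norm z
    rw [Complex.normSq_apply] at this
    nlinarith [norm_nonneg z]
  rw [Complex.div_im, ← sub_div]
  refine div_nonneg ?_ (Complex.normSq_nonneg _)
  have e1 : ((1 - z) ^ 2).re = (1 - z.re) ^ 2 - z.im ^ 2 := by simp [sq]
  have e2 : ((1 - z) ^ 2).im = -2 * (1 - z.re) * z.im := by simp [sq]; ring
  rw [e1, e2]
  have : z.im * ((1 - z.re) ^ 2 - z.im ^ 2) - z.re * (-2 * (1 - z.re) * z.im) =
    z.im * (1 - (z.re ^ 2 + z.im ^ 2)) := by ring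
  rw [this]
  exact mul_nonneg h0 (by linarith)

lemma hasSum_odd_mul_pow {z : ℂ} (hz : ‖z‖ < 1) :
    HasSum (fun n : ℕ => (2 * n + 1 : ℂ) * z ^ (2 * n + 1))
      ((z / (1 - z) ^ 2 + -(-z / (1 - -z) ^ 2)) / 2) := by
  have h1 := hasSum_coe_mul_geometric_of_norm_lt_one hz
  have h2 := hasSum_coe_mul_geometric_of_norm_lt_one (r := -z) (by simpa using hz)
  have h3 := (h1.add h2.neg).div_const 2
  have hinj : Function.Injective fun n : ℕ => 2 * n + 1 := fun a b h => by simpa using h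
  rw [← hinj.hasSum_iff] at h3
  · refine h3.congr_fun fun n => ?_
    simp only [Function.comp_apply]
    have : (-z) ^ (2 * n + 1) = -z ^ (2 * n + 1) := Odd.neg_pow ⟨n, rfl⟩ z
    rw [this]
    push_cast
    ring
  · intro n hn
    have he : Even n := by
      rw [← Nat.not_odd_iff_even]
      rintro ⟨k, rfl⟩
      exact hn ⟨k, rfl⟩
    rw [he.neg_pow]
    ring

/-- With `z = σ ^ 2 exp (2 i θ)` the sum `∑ m σ ^ m sin (m θ)` is the imaginary part of the sum of
`2 j z ^ j` over odd `j`, that is, of `z / (1 - z) ^ 2 + z / (1 + z) ^ 2`. -/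
lemma trigSeries_poisson_nonneg {σ : ℝ} (h0 : 0 ≤ σ) (h1 : σ < 1) {θ : ℝ}
    (hθ : θ ∈ Icc 0 (Real.pi / 2)) :
    0 ≤ trigSeries (fun n => freq n * σ ^ freq n) 0 0 1 θ := by
  set z : ℂ := ((σ ^ 2 : ℝ) : ℂ) * Complex.exp ((2 * θ : ℝ) * Complex.I) with hz
  have hn : ‖z‖ = σ ^ 2 := by
    rw [hz, norm_mul, Complex.norm_exp_ofReal_mul_I, Complex.norm_real, mul_one,
      Real.norm_of_nonneg (by positivity)]
  have hn1 : ‖z‖ < 1 := by rw [hn]; exact pow_lt_one₀ h0 h1 two_ne_zero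
  have him : z.im = σ ^ 2 * Real.sin (2 * θ) := by
    rw [hz, Complex.im_ofReal_mul, Complex.exp_ofReal_mul_I_im]
  have him0 : 0 ≤ z.im := by
    rw [him]
    exact mul_nonneg (by positivity)
      (Real.sin_nonneg_of_nonneg_of_le_pi (by linarith [hθ.1]) (by linarith [hθ.2]))
  have hs := (Complex.hasSum_im (hasSum_odd_mul_pow hn1)).mul_left 2
  have key : trigSeries (fun n => freq n * σ ^ freq n) 0 0 1 θ =
      2 * ((z / (1 - z) ^ 2 + -(-z / (1 - -z) ^ 2)) / 2).im := by
    rw [← hs.tsum_eq]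
    unfold trigSeries
    congr 1 with n
    have e : z ^ (2 * n + 1) = ((σ ^ freq n : ℝ) : ℂ) *
        Complex.exp ((freq n * θ : ℝ) * Complex.I) := by
      rw [hz, mul_pow, ← Complex.exp_nat_mul]
      congr 1
      · rw [← Complex.ofReal_pow, ← pow_mul]
        congr 2
        unfold freq; ring
      · congr 1
        simp only [freq]
        push_cast
        ring
    have e2 : ((2 : ℂ) * n + 1) = ((2 * n + 1 : ℝ) : ℂ) := by push_cast; rfl
    rw [e, e2, Complex.im_ofReal_mul, Complex.im_ofReal_mul, Complex.exp_ofReal_mul_I_im, add_zero,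
      one_pow]
    simp only [freq]
    push_cast
    ring
  rw [key]
  have p1 := im_div_one_sub_sq_nonneg him0 hn1
  have p2 : (-(-z / (1 - -z) ^ 2)).im = -(-z / (1 - -z) ^ 2).im := Complex.neg_im _
  -- complex conjugation exchanges the two half discs
  have p3 : 0 ≤ -(-z / (1 - -z) ^ 2).im := by
    have := im_div_one_sub_sq_nonneg (z := (starRingEnd ℂ) (-z)) (by simpa using him0)
      (by simpa using hn1)
    have e : (starRingEnd ℂ) (-z) / (1 - (starRingEnd ℂ) (-z)) ^ 2 =
      (starRingEnd ℂ) (-z / (1 - -z) ^ 2) := by simp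
    rw [e, Complex.conj_im] at this
    exact this
  have e3 : ((z / (1 - z) ^ 2 + -(-z / (1 - -z) ^ 2)) / 2).im =
      ((z / (1 - z) ^ 2).im + (-(-z / (1 - -z) ^ 2)).im) / 2 := by
    rw [Complex.div_ofNat_im, Complex.add_im]
  rw [e3, p2]
  linarith

lemma polyGrowth_freq_mul_pow {σ : ℝ} (h0 : 0 ≤ σ) (h1 : σ ≤ 1) :
    PolyGrowth fun n => freq n * σ ^ freq n :=
  polyGrowth_freq.mul (.of_abs_le_one fun n => by
    rw [abs_of_nonneg (by positivity)]; exact pow_le_one₀ h0 h1)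

/-- The series `∑ c_n r ^ (m_n ^ 2) sin (m_n θ)` solves the heat equation. -/
lemma trigSeries_heat (c : ℕ → ℝ) (r θ : ℝ) :
    r * trigSeries (fun n => c n * ((freq n ^ 2 - 0 : ℕ) : ℝ)) (0 + 1) 0 r θ +
      trigSeries (fun n => c n * freq n * freq n) 0 (0 + Real.pi / 2 + Real.pi / 2) r θ = 0 := by
  rw [mul_trigSeries_succ _ (by norm_num), trigSeries_half_add_half]
  have : (fun n => c n * ((freq n ^ 2 - 0 : ℕ) : ℝ)) = fun n => c n * freq n * freq n := by
    funext n
    push_cast [Nat.sub_zero]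
    ring
  rw [this, add_neg_cancel]

lemma trigSeries_freq_mul_pow_nonneg {σ : ℝ} (h0 : 0 ≤ σ) (h1 : σ < 1) {r θ : ℝ}
    (hr : r ∈ Ioo (0 : ℝ) 1) (hθ : θ ∈ Icc 0 (Real.pi / 2)) :
    0 ≤ trigSeries (fun n => freq n * σ ^ freq n) 0 0 r θ := by
  have hc := polyGrowth_freq_mul_pow h0 h1.le
  have hsum : Summable fun n : ℕ => |(freq n : ℝ) * σ ^ freq n| := by
    refine (polyGrowth_freq.summable h0 h1).of_nonneg_of_le (fun n => abs_nonneg _) fun n => ?_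
    rw [abs_mul, abs_of_nonneg (pow_nonneg h0 _)]
    exact mul_le_mul_of_nonneg_left (pow_le_pow_of_le_one h0 h1.le (by unfold freq; omega))
      (abs_nonneg _)
  have habs : ∀ s ∈ Ico r 1, |s| < 1 := fun s hs => by
    rw [abs_of_nonneg (hr.1.le.trans hs.1)]; exact hs.2
  refine nonneg_of_heat_supersolution (r₀ := r) (r₁ := 1) (a := 0) (b := Real.pi / 2) hr.1
    (h := fun r θ => trigSeries (fun n => freq n * σ ^ freq n) 0 0 r θ)
    ?_ (fun s hs φ _ => hasDerivAt_trigSeries_radius hc (by norm_num) 0 (habs s hs) φ)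
    (fun s hs φ _ => hasDerivAt_trigSeries_angle hc (by norm_num) 0 (habs s hs) φ)
    (fun s hs φ _ => hasDerivAt_trigSeries_angle (hc.mul polyGrowth_freq) (by norm_num) _
      (habs s hs) φ)
    (fun s _ φ _ => (trigSeries_heat _ s φ).le)
    (fun φ hφ => trigSeries_poisson_nonneg h0 h1 hφ)
    (fun s _ => (trigSeries_zero_angle _ _ _).ge) (fun s _ => (trigSeries_pi_div_two _ _ _).ge)
    r ⟨le_rfl, hr.2.le⟩ θ hθ
  exact (continuousOn_trigSeries hsum 0).mono
    (prod_mono (Icc_subset_Icc_left hr.1.le) (subset_univ _))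

lemma trigSeries_freq_nonneg {r θ : ℝ} (hr : r ∈ Ioo (0 : ℝ) 1)
    (hθ : θ ∈ Icc 0 (Real.pi / 2)) : 0 ≤ trigSeries (fun n => freq n) 0 0 r θ := by
  have habs : |r| < 1 := by rw [abs_of_pos hr.1]; exact hr.2
  have hcont : ContinuousOn (fun σ : ℝ => trigSeries (fun n => freq n * σ ^ freq n) 0 0 r θ)
      (Icc 0 1) := by
    refine continuousOn_tsum (fun n => by fun_prop) (polyGrowth_freq.summable hr.1.le hr.2) ?_
    intro n σ hσ
    refine (norm_trigSeries_term_le (c := fun n => freq n * σ ^ freq n) (by norm_num)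
      (abs_of_pos hr.1).le hr.2 0 θ n).trans ?_
    refine mul_le_mul_of_nonneg_right ?_ (pow_nonneg hr.1.le _)
    rw [abs_mul, abs_of_nonneg (pow_nonneg hσ.1 _)]
    exact mul_le_of_le_one_right (abs_nonneg _) (pow_le_one₀ hσ.1 hσ.2)
  have h1 : Tendsto (fun σ : ℝ => trigSeries (fun n => freq n * σ ^ freq n) 0 0 r θ)
      (𝓝[Ioo 0 1] 1) (𝓝 (trigSeries (fun n => freq n) 0 0 r θ)) := by
    have := (hcont 1 ⟨zero_le_one, le_rfl⟩).mono_left (nhdsWithin_mono 1 Ioo_subset_Icc_self)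
    simpa using this
  have : (𝓝[Ioo 0 1] (1 : ℝ)).NeBot := right_nhdsWithin_Ioo_neBot zero_lt_one
  refine ge_of_tendsto h1 ?_
  filter_upwards [self_mem_nhdsWithin] with σ hσ
  exact trigSeries_freq_mul_pow_nonneg hσ.1.le hσ.2 hr hθ

/-- Near `θ = 0` the series is bounded below, uniformly for `r` in a compact subinterval of
`(0, 1)`. -/
lemma exists_trigSeries_freq_lower_bound {r₀ r₁ : ℝ} (h0 : 0 < r₀) (h1 : r₁ < 1)
    {b : ℝ} (hb : 0 < b) :
    ∃ a ∈ Ioo 0 b, ∃ δ > 0, ∀ r ∈ Icc r₀ r₁, δ ≤ trigSeries (fun n => freq n) 0 0 r a := by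
  have hg : PolyGrowth fun n => (freq n : ℝ) * freq n * freq n * freq n :=
    ((polyGrowth_freq.mul polyGrowth_freq).mul polyGrowth_freq).mul polyGrowth_freq
  have hm (ρ : ℝ) : |max ρ 0| = max ρ 0 := abs_of_nonneg (le_max_right _ _)
  have hρ1 : max r₁ 0 < 1 := max_lt h1 zero_lt_one
  set Q := ∑' n : ℕ, |(freq n : ℝ) * freq n * freq n * freq n| * (max r₁ 0) ^ n with hQ
  have hQs := hg.summable (le_max_right r₁ 0) hρ1
  have hQ0 : 0 ≤ Q := tsum_nonneg fun n => by positivity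
  have hp : 0 < 4 * r₀ ^ 4 := by positivity
  obtain ⟨a, ha0, hab, haQ⟩ : ∃ a, 0 < a ∧ a < b ∧ a ^ 2 * Q < 4 * r₀ ^ 4 := by
    have hc : ContinuousAt (fun a : ℝ => a ^ 2 * Q) 0 := by fun_prop
    have e1 : ∀ᶠ a in 𝓝[>] (0 : ℝ), a ^ 2 * Q < 4 * r₀ ^ 4 :=
      (hc.eventually_lt continuousAt_const (by simpa using hp)).filter_mono nhdsWithin_le_nhds
    obtain ⟨a, ha, ha2⟩ := (e1.and (Ioo_mem_nhdsGT hb)).exists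
    exact ⟨a, ha2.1, ha2.2, ha⟩
  refine ⟨a, ⟨ha0, hab⟩, a * (4 * r₀ ^ 4 - a ^ 2 * Q), by
    have : 0 < 4 * r₀ ^ 4 - a ^ 2 * Q := by linarith
    positivity, fun r hr => ?_⟩
  have hr0 : 0 < r := h0.trans_le hr.1
  have habs : |r| < 1 := by rw [abs_of_pos hr0]; exact hr.2.trans_lt h1
  have s1 := summable_trigSeries (c := fun n => (freq n : ℝ) * freq n)
    (polyGrowth_freq.mul polyGrowth_freq) (k := 0) (by norm_num) habs (Real.pi / 2) 0
  have s2 := summable_trigSeries hg (k := 0) (by norm_num) habs (Real.pi / 2) 0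
  have s3 := summable_trigSeries polyGrowth_freq (k := 0) (by norm_num) habs 0 a
  simp only [mul_zero, zero_add, Real.sin_pi_div_two, mul_one, Nat.sub_zero] at s1 s2
  have l1 : 4 * r₀ ^ 4 ≤ ∑' n : ℕ, (freq n : ℝ) * freq n * r ^ (freq n ^ 2) := by
    refine le_trans ?_ (s1.le_tsum 0 fun n _ => by positivity)
    have : r₀ ^ 4 ≤ r ^ 4 := pow_le_pow_left₀ h0.le hr.1 4
    norm_num [freq]
    linarith
  have l2 : ∑' n : ℕ, (freq n : ℝ) * freq n * freq n * freq n * r ^ (freq n ^ 2) ≤ Q := by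
    refine s2.tsum_le_tsum (fun n => ?_) hQs
    rw [abs_of_nonneg (by positivity)]
    refine mul_le_mul_of_nonneg_left ?_ (by positivity)
    have := abs_pow_freq_le (k := 0) (by norm_num) (r := r) (ρ := max r₁ 0)
      (by rw [abs_of_pos hr0]; exact hr.2.trans (le_max_left _ _)) hρ1 n
    exact (le_abs_self _).trans this
  -- termwise `sin x ≥ x - x ^ 3 / 6 ≥ x - x ^ 3`
  have l3 : a * (∑' n : ℕ, (freq n : ℝ) * freq n * r ^ (freq n ^ 2)) -
      a ^ 3 * (∑' n : ℕ, (freq n : ℝ) * freq n * freq n * freq n * r ^ (freq n ^ 2)) ≤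
      trigSeries (fun n => freq n) 0 0 r a := by
    rw [← tsum_mul_left, ← tsum_mul_left,
      ← (s1.mul_left a).tsum_sub (s2.mul_left (a ^ 3))]
    refine ((s1.mul_left a).sub (s2.mul_left (a ^ 3))).tsum_le_tsum (fun n => ?_) s3
    have hx : 0 ≤ (freq n : ℝ) * a := by positivity
    have hsin := Real.sin_ge_sub_cube hx
    have hsin' : (freq n : ℝ) * a - (freq n * a) ^ 3 ≤ Real.sin (freq n * a) := by
      have : 0 ≤ ((freq n : ℝ) * a) ^ 3 := by positivity
      linarith
    have hpos : 0 ≤ (freq n : ℝ) * r ^ (freq n ^ 2) := by positivity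
    have := mul_le_mul_of_nonneg_left hsin' hpos
    rw [add_zero, Nat.sub_zero]
    calc _ = (freq n : ℝ) * r ^ (freq n ^ 2) * (freq n * a - (freq n * a) ^ 3) := by ring
      _ ≤ _ := this
  have l4 : a ^ 3 * (∑' n : ℕ, (freq n : ℝ) * freq n * freq n * freq n * r ^ (freq n ^ 2)) ≤
    a ^ 3 * Q := mul_le_mul_of_nonneg_left l2 (by positivity)
  have l5 := mul_le_mul_of_nonneg_left l1 ha0.le
  nlinarith

/-- Strict positivity: a nonnegative solution that is bounded below on the two sides of a strip
dominates the subsolution `κ ((r₀ / r) ^ (n ^ 2) cosh (n (θ - π / 4)) - 1 / 2)`, which is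
nonpositive at the initial time once `n` is large, and positive at the final time. -/
lemma trigSeries_freq_pos {r₀ θ : ℝ} (hr : r₀ ∈ Ioo (0 : ℝ) 1)
    (hθ : θ ∈ Ioo 0 (Real.pi / 2)) : 0 < trigSeries (fun n => freq n) 0 0 r₀ θ := by
  obtain ⟨r₁, h01, h1⟩ := exists_between hr.2
  have h0 := hr.1
  obtain ⟨a, ⟨ha0, hab⟩, δ, hδ, hlow⟩ := exists_trigSeries_freq_lower_bound h0 h1
    (b := min θ (Real.pi / 2 - θ)) (lt_min hθ.1 (by linarith [hθ.2]))
  have haθ : a < θ := hab.trans_le (min_le_left _ _)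
  have haθ' : θ < Real.pi / 2 - a := by linarith [hab.trans_le (min_le_right _ _)]
  have hr1 : 0 < r₁ := h0.trans h01
  set q := r₀ / r₁ with hq
  have hq0 : 0 < q := by positivity
  have hq1 : q < 1 := (div_lt_one hr1).2 h01
  obtain ⟨n, hn⟩ : ∃ n : ℕ, q ^ n * Real.exp (Real.pi / 4) ≤ 1 / 2 := by
    have : Tendsto (fun n : ℕ => q ^ n * Real.exp (Real.pi / 4)) atTop (𝓝 0) := by
      simpa using (tendsto_pow_atTop_nhds_zero_of_lt_one hq0.le hq1).mul_const
        (Real.exp (Real.pi / 4))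
    obtain ⟨n, hn⟩ := (this.eventually (gt_mem_nhds (by norm_num : (0 : ℝ) < 1 / 2))).exists
    exact ⟨n, hn.le⟩
  have hn0 : n ≠ 0 := by
    rintro rfl
    have := Real.add_one_le_exp (Real.pi / 4)
    simp only [pow_zero, one_mul] at hn
    linarith [Real.pi_pos]
  set C := Real.cosh (n * (Real.pi / 4)) with hC
  have hCpos : 0 < C := Real.cosh_pos _
  have hcosh (φ : ℝ) (hφ : φ ∈ Icc a (Real.pi / 2 - a)) :
      Real.cosh (n * (φ - Real.pi / 4)) ≤ C := by
    rw [hC, Real.cosh_le_cosh, abs_mul, abs_mul]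
    refine mul_le_mul_of_nonneg_left ?_ (abs_nonneg _)
    rw [abs_of_nonneg (by positivity : 0 ≤ Real.pi / 4), abs_le]
    constructor <;> linarith [hφ.1, hφ.2]
  have hCq : q ^ (n ^ 2) * C ≤ 1 / 2 := by
    have e1 : C ≤ Real.exp (Real.pi / 4) ^ n := by
      rw [← Real.exp_nat_mul, hC, Real.cosh_eq]
      have : Real.exp (-(n * (Real.pi / 4))) ≤ Real.exp (n * (Real.pi / 4)) := by
        apply Real.exp_le_exp.2
        have : 0 ≤ (n : ℝ) * (Real.pi / 4) := by positivity
        linarith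
      linarith
    calc q ^ (n ^ 2) * C ≤ q ^ (n ^ 2) * Real.exp (Real.pi / 4) ^ n := by gcongr
      _ = (q ^ n * Real.exp (Real.pi / 4)) ^ n := by rw [mul_pow, ← pow_mul, sq]
      _ ≤ (1 / 2) ^ n := by gcongr
      _ ≤ 1 / 2 := pow_le_of_le_one (by norm_num) (by norm_num) hn0
  set κ := δ / C with hκ
  have hκ0 : 0 < κ := by positivity
  have hκC : κ * C = δ := div_mul_cancel₀ _ hCpos.ne'
  have hside (r : ℝ) (hr' : r ∈ Icc r₀ r₁) (φ : ℝ) (hφ : φ ∈ Icc a (Real.pi / 2 - a)) :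
      κ * ((r₀ * r⁻¹) ^ (n ^ 2) * Real.cosh (n * (φ - Real.pi / 4)) - 1 / 2) ≤ δ := by
    have hrp : 0 < r := h0.trans_le hr'.1
    have h2 : (r₀ * r⁻¹) ^ (n ^ 2) ≤ 1 := by
      refine pow_le_one₀ (by positivity) ?_
      rw [← div_eq_mul_inv, div_le_one hrp]
      exact hr'.1
    rw [← hκC]
    refine mul_le_mul_of_nonneg_left ?_ hκ0.le
    have := mul_le_mul h2 (hcosh φ hφ) (Real.cosh_pos _).le zero_le_one
    linarith
  have habs : ∀ s ∈ Icc r₀ r₁, |s| < 1 := fun s hs => by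
    rw [abs_of_nonneg (h0.le.trans hs.1)]; exact hs.2.trans_lt h1
  have hcmp := nonneg_of_heat_supersolution (r₀ := r₀) (r₁ := r₁) (a := a)
    (b := Real.pi / 2 - a) h0
    (h := fun r θ => trigSeries (fun n => freq n) 0 0 r θ -
      κ * ((r₀ * r⁻¹) ^ (n ^ 2) * Real.cosh (n * (θ - Real.pi / 4)) - 1 / 2))
    (hr := fun r θ => trigSeries (fun n => freq n * ((freq n ^ 2 - 0 : ℕ) : ℝ)) (0 + 1) 0 r θ -
      κ * ((-(n ^ 2 : ℕ) * (r₀ * r⁻¹) ^ (n ^ 2) * r⁻¹) * Real.cosh (n * (θ - Real.pi / 4))))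
    (hθ := fun r θ => trigSeries (fun n => (freq n : ℝ) * freq n) 0 (0 + Real.pi / 2) r θ -
      κ * ((r₀ * r⁻¹) ^ (n ^ 2) * (Real.sinh (n * (θ - Real.pi / 4)) * n)))
    (hθθ := fun r θ =>
      trigSeries (fun n => (freq n : ℝ) * freq n * freq n) 0 (0 + Real.pi / 2 + Real.pi / 2) r θ -
      κ * ((r₀ * r⁻¹) ^ (n ^ 2) * ((Real.cosh (n * (θ - Real.pi / 4)) * n) * n)))
    ?_ ?_ ?_ ?_ ?_ ?_ ?_ ?_ r₀ ⟨le_rfl, h01.le⟩ θ ⟨haθ.le, haθ'.le⟩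
  · have hr0 : r₀ * r₀⁻¹ = 1 := mul_inv_cancel₀ h0.ne'
    rw [hr0, one_pow, one_mul] at hcmp
    have := Real.one_le_cosh (n * (θ - Real.pi / 4))
    nlinarith
  · refine ContinuousOn.sub ?_ ?_
    · rintro ⟨s, φ⟩ ⟨hs, -⟩
      exact (continuousAt_trigSeries polyGrowth_freq (by norm_num) 0
        (habs s hs) φ).continuousWithinAt
    · refine continuousOn_const.mul (ContinuousOn.sub (ContinuousOn.mul (ContinuousOn.pow
        (continuousOn_const.mul (continuousOn_fst.inv₀ ?_)) _) ?_) continuousOn_const)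
      · rintro ⟨s, φ⟩ ⟨hs, -⟩
        exact (h0.trans_le hs.1).ne'
      · exact (Real.continuous_cosh.comp (by fun_prop)).continuousOn
  · intro s hs φ _
    refine (hasDerivAt_trigSeries_radius polyGrowth_freq (by norm_num) 0
      (habs s (Ico_subset_Icc_self hs)) φ).sub ?_
    have hsp : s ≠ 0 := (h0.trans_le hs.1).ne'
    have hd := ((((hasDerivAt_inv hsp).const_mul r₀).pow (n ^ 2)).mul_const
      (Real.cosh (n * (φ - Real.pi / 4)))).sub_const (1 / 2)
    convert! hd.const_mul κ using 1
    have hn2 : n ^ 2 = n ^ 2 - 1 + 1 := by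
      have : 0 < n ^ 2 := by positivity
      omega
    have : (r₀ * s⁻¹) ^ (n ^ 2) = (r₀ * s⁻¹) ^ (n ^ 2 - 1) * (r₀ * s⁻¹) := by
      conv_lhs => rw [hn2, pow_succ]
    rw [this]
    simp only [sq s]
    field_simp
  · intro s hs φ _
    refine (hasDerivAt_trigSeries_angle polyGrowth_freq (by norm_num) 0
      (habs s (Ico_subset_Icc_self hs)) φ).sub ?_
    have hl : HasDerivAt (fun φ : ℝ => n * (φ - Real.pi / 4)) n φ := by
      simpa using! ((hasDerivAt_id φ).sub_const (Real.pi / 4)).const_mul (n : ℝ)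
    exact ((hl.cosh.const_mul ((r₀ * s⁻¹) ^ (n ^ 2))).sub_const (1 / 2)).const_mul κ
  · intro s hs φ _
    refine (hasDerivAt_trigSeries_angle (polyGrowth_freq.mul polyGrowth_freq) (by norm_num) _
      (habs s (Ico_subset_Icc_self hs)) φ).sub ?_
    have hl : HasDerivAt (fun φ : ℝ => n * (φ - Real.pi / 4)) n φ := by
      simpa using! ((hasDerivAt_id φ).sub_const (Real.pi / 4)).const_mul (n : ℝ)
    exact ((hl.sinh.mul_const (n : ℝ)).const_mul ((r₀ * s⁻¹) ^ (n ^ 2))).const_mul κ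
  · intro s hs φ _
    have hsp : s ≠ 0 := (h0.trans_le hs.1).ne'
    have := trigSeries_heat (fun n => freq n) s φ
    push_cast at this ⊢
    field_simp at this ⊢
    linarith
  · intro φ hφ
    have hK := trigSeries_freq_nonneg (r := r₁) (θ := φ) ⟨hr1, h1⟩
      ⟨by linarith [hφ.1], by linarith [hφ.2]⟩
    have : (r₀ * r₁⁻¹) ^ (n ^ 2) * Real.cosh (n * (φ - Real.pi / 4)) ≤ 1 / 2 := by
      rw [← div_eq_mul_inv]
      refine le_trans ?_ hCq
      gcongr
      exact hcosh φ hφ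
    have := mul_nonneg hκ0.le (sub_nonneg.2 this)
    linarith
  · intro s hs
    have h2 := hside s hs a ⟨le_rfl, by linarith⟩
    have h3 := hlow s hs
    linarith
  · intro s hs
    have h2 := hside s hs (Real.pi / 2 - a) ⟨by linarith, le_rfl⟩
    have h3 := hlow s hs
    rw [← trigSeries_reflect] at h3
    linarith

/-- The series `∑ r ^ (m ^ 2) cos (m θ)` vanishes in `(0, π / 2)` at `θ = π / 4` only: it vanishes
there and is strictly decreasing. -/
lemma trigSeries_one_ne_zero {r θ : ℝ} (hr : r ∈ Ioo (0 : ℝ) 1)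
    (hθ : θ ∈ Ioo 0 (Real.pi / 2)) (hne : θ ≠ Real.pi / 4) :
    trigSeries (fun _ => 1) 0 (Real.pi / 2) r θ ≠ 0 := by
  have habs : |r| < 1 := by rw [abs_of_pos hr.1]; exact hr.2
  have hone : PolyGrowth fun _ => (1 : ℝ) := .of_abs_le_one fun _ => by simp
  have hd (φ : ℝ) : HasDerivAt (fun φ => trigSeries (fun _ => 1) 0 (Real.pi / 2) r φ)
      (-trigSeries (fun n => freq n) 0 0 r φ) φ := by
    have := hasDerivAt_trigSeries_angle hone (k := 0) (by norm_num) (Real.pi / 2) habs φ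
    rw [← trigSeries_half_add_half]
    simpa only [zero_add, one_mul] using this
  have hanti : StrictAntiOn (fun φ => trigSeries (fun _ => 1) 0 (Real.pi / 2) r φ)
      (Ioo 0 (Real.pi / 2)) := by
    refine strictAntiOn_of_deriv_neg (convex_Ioo _ _)
      (fun φ _ => (hd φ).continuousAt.continuousWithinAt) fun φ hφ => ?_
    rw [interior_Ioo] at hφ
    rw [(hd φ).deriv]
    exact neg_neg_of_pos (trigSeries_freq_pos hr hφ)
  have hmid := trigSeries_pi_div_four (fun _ => 1) 0 r
  have hpi := Real.pi_pos
  intro h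
  exact hne (hanti.injOn hθ ⟨by linarith, by linarith⟩ (h.trans hmid.symm))

/-! ### The potential `W` and its partial derivatives -/

/-- The coefficients of `W`. -/
def potCoeff (n : ℕ) : ℝ := 8 / Real.pi * (1 / (((freq n : ℝ) ^ 2 - 1) * freq n))

lemma W_eq_trigSeries (r θ : ℝ) : W r θ = trigSeries potCoeff 0 0 r θ := by
  unfold W trigSeries
  rw [← tsum_mul_left]
  congr 1 with n
  simp only [potCoeff, freq, Nat.sub_zero, add_zero]
  ring

/-- The partial derivative `W_r`, as the termwise differentiated series. -/
def Wr (r θ : ℝ) : ℝ := trigSeries (fun n => potCoeff n * freq n ^ 2) 1 0 r θ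

/-- The partial derivative `W_θ`, as the termwise differentiated series. -/
def Wt (r θ : ℝ) : ℝ := trigSeries (fun n => potCoeff n * freq n) 0 (Real.pi / 2) r θ

/-- The second partial derivative `W_rr`, as the termwise differentiated series. -/
def Wrr (r θ : ℝ) : ℝ := 8 / Real.pi * trigSeries (fun n => freq n) 2 0 r θ

/-- The second partial derivative `W_rθ`, as the termwise differentiated series. -/
def Wrt (r θ : ℝ) : ℝ := trigSeries (fun n => potCoeff n * freq n ^ 3) 1 (Real.pi / 2) r θ

lemma freq_sq_sub_one_pos (n : ℕ) : 0 < (freq n : ℝ) ^ 2 - 1 := by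
  nlinarith [two_le_freq n]

lemma potCoeff_nonneg (n : ℕ) : 0 ≤ potCoeff n := by
  have := freq_sq_sub_one_pos n
  unfold potCoeff
  positivity

lemma potCoeff_mul_freq (n : ℕ) :
    potCoeff n * freq n = 8 / Real.pi * (1 / ((freq n : ℝ) ^ 2 - 1)) := by
  have h1 := freq_sq_sub_one_pos n
  have h2 := two_le_freq n
  have h3 : (freq n : ℝ) ≠ 0 := by positivity
  unfold potCoeff
  field_simp

lemma potCoeff_mul_freq_le (n : ℕ) :
    potCoeff n * freq n ≤ 8 / Real.pi * (1 / ((n : ℝ) + 1) ^ 2) := by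
  rw [potCoeff_mul_freq]
  refine mul_le_mul_of_nonneg_left ?_ (by positivity)
  refine one_div_le_one_div_of_le (by positivity) ?_
  have : (freq n : ℝ) = 4 * n + 2 := by simp [freq]
  rw [this]
  nlinarith [Nat.cast_nonneg (α := ℝ) n]

lemma summable_potCoeff_mul_freq : Summable fun n => |potCoeff n * freq n| := by
  have h : Summable fun n : ℕ => 8 / Real.pi * (1 / ((n : ℝ) + 1) ^ 2) := by
    have := (summable_nat_add_iff 1).2 (Real.summable_one_div_nat_pow.2 one_lt_two)
    simpa using this.mul_left (8 / Real.pi)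
  refine h.of_nonneg_of_le (fun n => abs_nonneg _) fun n => ?_
  rw [abs_of_nonneg (mul_nonneg (potCoeff_nonneg n) (Nat.cast_nonneg _))]
  exact potCoeff_mul_freq_le n

lemma summable_potCoeff : Summable fun n => |potCoeff n| := by
  refine summable_potCoeff_mul_freq.of_nonneg_of_le (fun n => abs_nonneg _) fun n => ?_
  rw [abs_mul, Nat.abs_cast]
  exact le_mul_of_one_le_right (abs_nonneg _) (by linarith [two_le_freq n])

lemma potCoeff_mul (n : ℕ) :
    potCoeff n * (freq n : ℝ) ^ 2 * ((freq n ^ 2 - 1 : ℕ) : ℝ) = 8 / Real.pi * freq n := by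
  have h1 := freq_sq_sub_one_pos n
  have h2 := two_le_freq n
  have h3 : (freq n : ℝ) ≠ 0 := by positivity
  have : 1 ≤ freq n ^ 2 := by unfold freq; nlinarith [Nat.zero_le n]
  rw [Nat.cast_sub this]
  unfold potCoeff
  push_cast
  field_simp

lemma polyGrowth_potCoeff : PolyGrowth potCoeff := by
  obtain ⟨N, hN⟩ : PolyGrowth fun _ => (1 : ℝ) := .of_abs_le_one fun _ => by simp
  refine ⟨N, Asymptotics.IsBigO.trans ?_ hN⟩
  exact (summable_potCoeff.of_abs.tendsto_atTop_zero.isBigO_one ℝ)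

lemma polyGrowth_potCoeff_mul_pow (k : ℕ) : PolyGrowth fun n => potCoeff n * (freq n : ℝ) ^ k := by
  induction k with
  | zero => simpa using polyGrowth_potCoeff
  | succ k ih => simpa only [pow_succ, mul_assoc] using ih.mul polyGrowth_freq

lemma trigSeries_const_mul (a : ℝ) (c : ℕ → ℝ) (k : ℕ) (α r θ : ℝ) :
    trigSeries (fun n => a * c n) k α r θ = a * trigSeries c k α r θ := by
  unfold trigSeries
  rw [← tsum_mul_left]
  congr 1 with n
  ring

lemma hasFDerivAt_W {r : ℝ} (hr : |r| < 1) (θ : ℝ) :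
    HasFDerivAt (fun p : ℝ × ℝ => W p.1 p.2)
      (Wr r θ • ContinuousLinearMap.fst ℝ ℝ ℝ + Wt r θ • ContinuousLinearMap.snd ℝ ℝ ℝ) (r, θ) := by
  simp_rw [W_eq_trigSeries]
  have := hasFDerivAt_trigSeries polyGrowth_potCoeff (k := 0) (by norm_num) 0 hr θ
  simpa [Wr, Wt] using this

lemma hasStrictFDerivAt_Wr {r : ℝ} (hr : |r| < 1) (θ : ℝ) :
    HasStrictFDerivAt (fun p : ℝ × ℝ => Wr p.1 p.2)
      (Wrr r θ • ContinuousLinearMap.fst ℝ ℝ ℝ + Wrt r θ • ContinuousLinearMap.snd ℝ ℝ ℝ)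
      (r, θ) := by
  have := hasStrictFDerivAt_trigSeries (polyGrowth_potCoeff_mul_pow 2) (k := 1) le_rfl 0 hr θ
  simp_rw [potCoeff_mul] at this
  rw [trigSeries_const_mul] at this
  simpa only [Wr, Wrr, Wrt, zero_add, mul_assoc, ← pow_succ] using this

lemma hasFDerivAt_Wt {r : ℝ} (hr : |r| < 1) (θ : ℝ) :
    HasFDerivAt (fun p : ℝ × ℝ => Wt p.1 p.2)
      (Wrt r θ • ContinuousLinearMap.fst ℝ ℝ ℝ + (-(r * Wr r θ)) • ContinuousLinearMap.snd ℝ ℝ ℝ)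
      (r, θ) := by
  have := hasFDerivAt_trigSeries (polyGrowth_potCoeff.mul polyGrowth_freq) (k := 0) (by norm_num)
    (Real.pi / 2) hr θ
  have e1 : (fun n => potCoeff n * freq n * ((freq n ^ 2 - 0 : ℕ) : ℝ)) =
      fun n => potCoeff n * (freq n : ℝ) ^ 3 := by
    funext n
    push_cast [Nat.sub_zero]
    ring
  have e2 : (fun n => potCoeff n * (freq n : ℝ) * freq n) =
      fun n => potCoeff n * (freq n : ℝ) ^ 2 := by
    funext n
    ring
  have e3 := trigSeries_half_add_half (fun n => potCoeff n * (freq n : ℝ) ^ 2) 0 r θ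
  rw [zero_add] at e3
  rw [e1, e2, e3] at this
  rw [Wr, mul_trigSeries_succ _ (by norm_num)]
  exact this

lemma hasDerivAt_W_radius {r : ℝ} (hr : |r| < 1) (θ : ℝ) :
    HasDerivAt (fun s => W s θ) (Wr r θ) r := by
  simpa using! (hasFDerivAt_W hr θ).comp_hasDerivAt r
    ((hasDerivAt_id r).prodMk (hasDerivAt_const r θ))

lemma hasDerivAt_W_angle {r : ℝ} (hr : |r| < 1) (θ : ℝ) :
    HasDerivAt (fun s => W r s) (Wt r θ) θ := by
  simpa using! (hasFDerivAt_W hr θ).comp_hasDerivAt θ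
    ((hasDerivAt_const θ r).prodMk (hasDerivAt_id θ))

lemma hasDerivAt_Wr_radius {r : ℝ} (hr : |r| < 1) (θ : ℝ) :
    HasDerivAt (fun s => Wr s θ) (Wrr r θ) r := by
  simpa using! (hasStrictFDerivAt_Wr hr θ).hasFDerivAt.comp_hasDerivAt r
    ((hasDerivAt_id r).prodMk (hasDerivAt_const r θ))

lemma hasDerivAt_Wr_angle {r : ℝ} (hr : |r| < 1) (θ : ℝ) :
    HasDerivAt (fun s => Wr r s) (Wrt r θ) θ := by
  simpa using! (hasStrictFDerivAt_Wr hr θ).hasFDerivAt.comp_hasDerivAt θ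
    ((hasDerivAt_const θ r).prodMk (hasDerivAt_id θ))

lemma hasDerivAt_Wt_angle {r : ℝ} (hr : |r| < 1) (θ : ℝ) :
    HasDerivAt (fun s => Wt r s) (-(r * Wr r θ)) θ := by
  simpa using! (hasFDerivAt_Wt hr θ).comp_hasDerivAt θ
    ((hasDerivAt_const θ r).prodMk (hasDerivAt_id θ))

lemma Wrr_pos {r θ : ℝ} (hr : r ∈ Ioo (0 : ℝ) 1) (hθ : θ ∈ Ioo 0 (Real.pi / 2)) :
    0 < Wrr r θ := by
  have h := trigSeries_freq_pos hr hθ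
  rw [← mul_trigSeries_succ _ (by norm_num), ← mul_trigSeries_succ _ (by norm_num)] at h
  have h2 : 0 < trigSeries (fun n => freq n) (0 + 1 + 1) 0 r θ :=
    pos_of_mul_pos_right (pos_of_mul_pos_right h hr.1.le) hr.1.le
  exact mul_pos (by positivity) h2

/-- The quantity `r W_rθ - W_θ`, which decides on the nondegeneracy of the minimax point and of the
Hessian matrix of `w`, vanishes on the ray `θ = π / 4` only. -/
lemma mul_Wrt_sub_Wt_ne_zero {r θ : ℝ} (hr : r ∈ Ioo (0 : ℝ) 1)
    (hθ : θ ∈ Ioo 0 (Real.pi / 2)) (hne : θ ≠ Real.pi / 4) : r * Wrt r θ - Wt r θ ≠ 0 := by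
  have habs : |r| < 1 := by rw [abs_of_pos hr.1]; exact hr.2
  have e : r * Wrt r θ - Wt r θ =
      8 / Real.pi * trigSeries (fun _ => 1) 0 (Real.pi / 2) r θ := by
    rw [Wrt, mul_trigSeries_succ _ (by norm_num), Wt]
    have s1 := summable_trigSeries (polyGrowth_potCoeff_mul_pow 3) (k := 0) (by norm_num) habs
      (Real.pi / 2) θ
    have s2 := summable_trigSeries (polyGrowth_potCoeff.mul polyGrowth_freq) (k := 0)
      (by norm_num) habs (Real.pi / 2) θ
    unfold trigSeries
    rw [← s1.tsum_sub s2, ← tsum_mul_left]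
    congr 1 with n
    have h1 := freq_sq_sub_one_pos n
    have : potCoeff n * (freq n : ℝ) ^ 3 = potCoeff n * freq n + 8 / Real.pi := by
      have e : potCoeff n * (freq n : ℝ) ^ 3 = potCoeff n * freq n * freq n ^ 2 := by ring
      rw [e, potCoeff_mul_freq]
      field_simp
      ring
    rw [this]
    ring
  rw [e]
  exact mul_ne_zero (by positivity) (trigSeries_one_ne_zero hr hθ hne)

lemma W_zero_angle (r : ℝ) : W r 0 = 0 := by
  rw [W_eq_trigSeries, trigSeries_zero_angle]

lemma W_pi_div_two (r : ℝ) : W r (Real.pi / 2) = 0 := by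
  rw [W_eq_trigSeries, trigSeries_pi_div_two]

lemma W_reflect (r θ : ℝ) : W r (Real.pi / 2 - θ) = W r θ := by
  rw [W_eq_trigSeries, W_eq_trigSeries, trigSeries_reflect]

lemma continuousOn_W : ContinuousOn (fun p : ℝ × ℝ => W p.1 p.2) (Icc 0 1 ×ˢ univ) := by
  simp_rw [W_eq_trigSeries]
  exact continuousOn_trigSeries summable_potCoeff 0

lemma continuousOn_Wt : ContinuousOn (fun p : ℝ × ℝ => Wt p.1 p.2) (Icc 0 1 ×ˢ univ) :=
  continuousOn_trigSeries summable_potCoeff_mul_freq _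

/-! ### The values of `W` at `r = 1` -/

lemma hasDerivAt_trigSeries_angle_of_summable {c : ℕ → ℝ} (hc : Summable fun n => |c n|)
    (hc' : Summable fun n => |c n * freq n|) (α : ℝ) {r : ℝ} (hr : r ∈ Icc (0 : ℝ) 1) (θ : ℝ) :
    HasDerivAt (fun s => trigSeries c 0 α r s)
      (trigSeries (fun n => c n * freq n) 0 (α + Real.pi / 2) r θ) θ := by
  have hle (d : ℕ → ℝ) (n : ℕ) (β φ : ℝ) :
      ‖d n * r ^ (freq n ^ 2 - 0) * Real.sin (freq n * φ + β)‖ ≤ |d n| := by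
    rw [Real.norm_eq_abs, abs_mul, abs_mul, abs_of_nonneg (pow_nonneg hr.1 _)]
    calc |d n| * r ^ (freq n ^ 2 - 0) * |Real.sin (freq n * φ + β)| ≤ |d n| * 1 * 1 := by
          gcongr
          · exact pow_le_one₀ hr.1 hr.2
          · exact Real.abs_sin_le_one _
      _ = _ := by ring
  refine hasDerivAt_tsum hc' (g := fun n φ => c n * r ^ (freq n ^ 2 - 0) *
    Real.sin (freq n * φ + α)) (y₀ := 0) (fun n φ => ?_)
    (fun n φ => hle (fun n => c n * freq n) n (α + Real.pi / 2) φ)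
    (Summable.of_norm_bounded hc fun n => hle c n α 0) θ
  have h1 : HasDerivAt (fun φ : ℝ => freq n * φ + α) (freq n) φ := by
    simpa using! ((hasDerivAt_id φ).const_mul (freq n : ℝ)).add_const α
  convert! h1.sin.const_mul (c n * r ^ (freq n ^ 2 - 0)) using 1
  rw [← add_assoc, Real.sin_add_pi_div_two]
  ring

lemma hasDerivAt_W_angle_of_mem_Icc {r : ℝ} (hr : r ∈ Icc (0 : ℝ) 1) (θ : ℝ) :
    HasDerivAt (fun s => W r s) (Wt r θ) θ := by
  simp_rw [W_eq_trigSeries]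
  have := hasDerivAt_trigSeries_angle_of_summable summable_potCoeff summable_potCoeff_mul_freq 0
    hr θ
  simpa [Wt] using this

/-- The sum `∑ sin (m θ) / m ^ 3`, from the Fourier series of the third Bernoulli polynomial. -/
lemma hasSum_sin_div_freq_cube {θ : ℝ} (hθ : θ ∈ Icc 0 (Real.pi / 2)) :
    HasSum (fun n : ℕ => 8 / Real.pi * (1 / (freq n : ℝ) ^ 3) * Real.sin (freq n * θ))
      (θ * (Real.pi / 2 - θ) / 2) := by
  have hpi := Real.pi_pos
  have hB (x : ℝ) : (Polynomial.map (algebraMap ℚ ℝ) (Polynomial.bernoulli (2 * 1 + 1))).eval x =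
      x ^ 3 - 3 / 2 * x ^ 2 + x / 2 := by
    rw [show 2 * 1 + 1 = 3 by norm_num, Polynomial.bernoulli_def]
    simp [Finset.sum_range_succ, bernoulli_eq_bernoulli'_of_ne_one, bernoulli'_two, bernoulli_one,
      bernoulli'_three, Nat.choose]
    ring
  have h1 := hasSum_one_div_nat_pow_mul_sin one_ne_zero (x := θ / Real.pi)
    ⟨by have := hθ.1; positivity, by rw [div_le_one hpi]; linarith [hθ.2]⟩
  have h2 := hasSum_one_div_nat_pow_mul_sin one_ne_zero (x := 2 * θ / Real.pi)
    ⟨by have := hθ.1; positivity, by rw [div_le_one hpi]; linarith [hθ.2]⟩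
  rw [hB] at h1 h2
  set F : ℕ → ℝ := fun n => 1 / (n : ℝ) ^ (2 * 1 + 1) * Real.sin (2 * Real.pi * n * (θ / Real.pi))
    with hF
  have heven : HasSum (fun n => F (2 * n)) (1 / 8 * ((-1 : ℝ) ^ (1 + 1) *
      (2 * Real.pi) ^ (2 * 1 + 1) / 2 / ((2 * 1 + 1).factorial : ℝ) *
      ((2 * θ / Real.pi) ^ 3 - 3 / 2 * (2 * θ / Real.pi) ^ 2 + 2 * θ / Real.pi / 2))) := by
    refine (h2.mul_left (1 / 8)).congr_fun fun n => ?_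
    simp only [hF]
    rw [show (2 * Real.pi * ((2 * n : ℕ) : ℝ) * (θ / Real.pi)) =
      2 * Real.pi * n * (2 * θ / Real.pi) by push_cast; ring, ← mul_assoc]
    congr 1
    push_cast
    rw [mul_pow]
    norm_num
    ring
  have hodd : Summable fun n => F (2 * n + 1) :=
    h1.summable.comp_injective fun a b h => by simpa using h
  have htot := heven.even_add_odd hodd.hasSum
  have hval := htot.unique h1
  have h3 : HasSum (fun n => F (2 * n + 1)) (Real.pi * (θ * (Real.pi / 2 - θ) / 2)) := by
    have : ∑' n, F (2 * n + 1) = Real.pi * (θ * (Real.pi / 2 - θ) / 2) := by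
      rw [← eq_sub_iff_add_eq'] at hval
      rw [hval]
      norm_num [Nat.factorial]
      field_simp
      ring
    rw [← this]
    exact hodd.hasSum
  have h4 := h3.mul_left (1 / Real.pi)
  rw [← mul_assoc, one_div_mul_cancel hpi.ne', one_mul] at h4
  refine h4.congr_fun fun n => ?_
  simp only [hF]
  have : 2 * Real.pi * ((2 * n + 1 : ℕ) : ℝ) * (θ / Real.pi) = freq n * θ := by
    simp only [freq]
    push_cast
    field_simp
    ring
  rw [this, ← mul_assoc]
  congr 1
  have e : (freq n : ℝ) = 2 * ((2 * n + 1 : ℕ) : ℝ) := by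
    simp only [freq]; push_cast; ring
  rw [e, mul_pow]
  field_simp
  norm_num

lemma eq_of_hasDerivAt_eq_zero {f : ℝ → ℝ} {a b : ℝ} (hc : ContinuousOn f (Icc a b))
    (hd : ∀ x ∈ Ioo a b, HasDerivAt f 0 x) : ∀ x ∈ Icc a b, f x = f a := by
  intro x hx
  rcases hx.1.eq_or_lt with rfl | h
  · rfl
  obtain ⟨c, hc, he⟩ := exists_hasDerivAt_eq_slope f (fun _ => 0) h
    (hc.mono (Icc_subset_Icc_right hx.2)) fun y hy => hd y ⟨hy.1, hy.2.trans_le hx.2⟩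
  rw [eq_comm, div_eq_zero_iff] at he
  rcases he with he | he <;> linarith

/-- On `[0, π / 2]` the function `W(1, ·) + 1` solves `k'' = -k`, `k(0) = k(π / 2) = 1`. -/
lemma W_one_and_Wt_one {θ : ℝ} (hθ : θ ∈ Icc 0 (Real.pi / 2)) :
    W 1 θ = Real.cos θ + Real.sin θ - 1 ∧ Wt 1 θ = Real.cos θ - Real.sin θ := by
  have hpi := Real.pi_pos
  have h11 : (1 : ℝ) ∈ Icc (0 : ℝ) 1 := ⟨zero_le_one, le_rfl⟩
  -- `1 / (m (m ^ 2 - 1)) = 1 / m ^ 3 + 1 / (m ^ 3 (m ^ 2 - 1))`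
  set b : ℕ → ℝ := fun n => potCoeff n / (freq n : ℝ) ^ 2 with hb
  have hb1 (n : ℕ) : b n * freq n * freq n = potCoeff n := by
    have h3 : (freq n : ℝ) ≠ 0 := by linarith [two_le_freq n]
    simp only [hb]
    field_simp
  have hle (n : ℕ) : |b n * freq n| ≤ |potCoeff n| := by
    calc |b n * freq n| ≤ |b n * freq n| * freq n :=
          le_mul_of_one_le_right (abs_nonneg _) (by linarith [two_le_freq n])
      _ = |potCoeff n| := by rw [← hb1 n, abs_mul (b n * freq n) (freq n : ℝ), Nat.abs_cast]
  have hle2 (n : ℕ) : |b n| ≤ |potCoeff n| := by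
    refine le_trans ?_ (hle n)
    rw [abs_mul, Nat.abs_cast]
    exact le_mul_of_one_le_right (abs_nonneg _) (by linarith [two_le_freq n])
  have hs0 : Summable fun n => |b n| :=
    summable_potCoeff.of_nonneg_of_le (fun _ => abs_nonneg _) hle2
  have hs1 : Summable fun n => |b n * freq n| :=
    summable_potCoeff.of_nonneg_of_le (fun _ => abs_nonneg _) hle
  have hs2 : Summable fun n => |b n * freq n * freq n| := by
    simp_rw [hb1]; exact summable_potCoeff
  have hsplit : ∀ φ ∈ Icc 0 (Real.pi / 2),
      W 1 φ = φ * (Real.pi / 2 - φ) / 2 + trigSeries b 0 0 1 φ := by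
    intro φ hφ
    have hsum : Summable fun n => b n * 1 ^ (freq n ^ 2 - 0) * Real.sin (freq n * φ + 0) := by
      refine Summable.of_norm_bounded hs0 fun n => ?_
      rw [one_pow, mul_one, Real.norm_eq_abs, abs_mul]
      exact mul_le_of_le_one_right (abs_nonneg _) (Real.abs_sin_le_one _)
    rw [← (hasSum_sin_div_freq_cube hφ).tsum_eq, W_eq_trigSeries]
    unfold trigSeries
    rw [← (hasSum_sin_div_freq_cube hφ).summable.tsum_add hsum]
    congr 1 with n
    have h1 := freq_sq_sub_one_pos n
    have h3 : (freq n : ℝ) ≠ 0 := by linarith [two_le_freq n]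
    have : potCoeff n = 8 / Real.pi * (1 / (freq n : ℝ) ^ 3) + b n := by
      simp only [hb, potCoeff]
      field_simp
      ring
    rw [this, one_pow, add_zero]
    ring
  have hW1 (φ : ℝ) : HasDerivAt (fun s => W 1 s) (Wt 1 φ) φ := hasDerivAt_W_angle_of_mem_Icc h11 φ
  have hb' (φ : ℝ) : HasDerivAt (fun s => trigSeries b 0 0 1 s)
      (trigSeries (fun n => b n * freq n) 0 (0 + Real.pi / 2) 1 φ) φ :=
    hasDerivAt_trigSeries_angle_of_summable hs0 hs1 0 h11 φ
  have hb'' (φ : ℝ) : HasDerivAt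
      (fun s => trigSeries (fun n => b n * freq n) 0 (0 + Real.pi / 2) 1 s) (-W 1 φ) φ := by
    have := hasDerivAt_trigSeries_angle_of_summable hs1 hs2 (0 + Real.pi / 2) h11 φ
    rw [trigSeries_half_add_half] at this
    simp_rw [hb1] at this
    rwa [W_eq_trigSeries]
  have hWt : ∀ φ ∈ Ioo 0 (Real.pi / 2), Wt 1 φ =
      Real.pi / 4 - φ + trigSeries (fun n => b n * freq n) 0 (0 + Real.pi / 2) 1 φ := by
    intro φ hφ
    refine (hW1 φ).unique (HasDerivAt.congr_of_eventuallyEq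
      (f := fun s => s * (Real.pi / 2 - s) / 2 + trigSeries b 0 0 1 s) ?_ ?_)
    · refine HasDerivAt.add ?_ (hb' φ)
      convert! ((hasDerivAt_id φ).mul ((hasDerivAt_id φ).const_sub (Real.pi / 2))).div_const 2
        using 1
      simp only [id]
      ring
    · filter_upwards [Ioo_mem_nhds hφ.1 hφ.2] with s hs using hsplit s (Ioo_subset_Icc_self hs)
  have hWtt : ∀ φ ∈ Ioo 0 (Real.pi / 2), HasDerivAt (fun s => Wt 1 s) (-(W 1 φ + 1)) φ := by
    intro φ hφ
    refine HasDerivAt.congr_of_eventuallyEq (f := fun s => Real.pi / 4 - s +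
      trigSeries (fun n => b n * freq n) 0 (0 + Real.pi / 2) 1 s) ?_ ?_
    · convert! ((hasDerivAt_id φ).const_sub (Real.pi / 4)).add (hb'' φ) using 1
      ring
    · filter_upwards [Ioo_mem_nhds hφ.1 hφ.2] with s hs using hWt s hs
  have hcont0 : Continuous fun s => W 1 s :=
    continuous_iff_continuousAt.2 fun φ => (hW1 φ).continuousAt
  have hcont1 : Continuous fun s => Wt 1 s :=
    continuousOn_Wt.comp_continuous (f := fun s : ℝ => ((1 : ℝ), s)) (by fun_prop)
      fun s => ⟨h11, mem_univ _⟩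
  have c1 : ∀ φ ∈ Icc 0 (Real.pi / 2),
      (W 1 φ + 1) * Real.cos φ - Wt 1 φ * Real.sin φ = 1 := by
    intro φ hφ
    rw [eq_of_hasDerivAt_eq_zero (a := 0) (b := Real.pi / 2)
      (f := fun φ => (W 1 φ + 1) * Real.cos φ - Wt 1 φ * Real.sin φ) (by fun_prop) ?_ φ hφ]
    · simp [W_zero_angle]
    · intro s hs
      convert! (((hW1 s).add_const 1).mul (Real.hasDerivAt_cos s)).sub
        ((hWtt s hs).mul (Real.hasDerivAt_sin s)) using 1
      ring
  have c2 : ∀ φ ∈ Icc 0 (Real.pi / 2),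
      (W 1 φ + 1) * Real.sin φ + Wt 1 φ * Real.cos φ = 1 := by
    have hconst := eq_of_hasDerivAt_eq_zero (a := 0) (b := Real.pi / 2)
      (f := fun φ => (W 1 φ + 1) * Real.sin φ + Wt 1 φ * Real.cos φ) (by fun_prop) (by
        intro s hs
        convert! (((hW1 s).add_const 1).mul (Real.hasDerivAt_sin s)).add
          ((hWtt s hs).mul (Real.hasDerivAt_cos s)) using 1
        ring)
    intro φ hφ
    rw [hconst φ hφ, ← hconst (Real.pi / 2) ⟨by positivity, le_rfl⟩]
    simp [W_pi_div_two]
  have e := Real.sin_sq_add_cos_sq θ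
  constructor
  · linear_combination Real.cos θ * c1 θ hθ + Real.sin θ * c2 θ hθ - (W 1 θ + 1) * e
  · linear_combination Real.cos θ * c2 θ hθ - Real.sin θ * c1 θ hθ - Wt 1 θ * e

lemma one_le_cos_add_sin {θ : ℝ} (hθ : θ ∈ Icc 0 (Real.pi / 2)) :
    1 ≤ Real.cos θ + Real.sin θ := by
  have hc := Real.cos_nonneg_of_mem_Icc ⟨by linarith [hθ.1, Real.pi_pos], hθ.2⟩
  have hs := Real.sin_nonneg_of_nonneg_of_le_pi hθ.1 (by linarith [hθ.2, Real.pi_pos])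
  nlinarith [Real.sin_sq_add_cos_sq θ, Real.sin_le_one θ, Real.cos_le_one θ, mul_nonneg hc hs]

lemma W_nonneg {r θ : ℝ} (hr : r ∈ Icc (0 : ℝ) 1) (hθ : θ ∈ Icc 0 (Real.pi / 2)) :
    0 ≤ W r θ := by
  rcases hr.1.eq_or_lt with rfl | h0
  · rw [W_eq_trigSeries, trigSeries_zero_radius _ (by norm_num)]
  have habs : ∀ s ∈ Ico r 1, |s| < 1 := fun s hs => by
    rw [abs_of_nonneg (h0.le.trans hs.1)]; exact hs.2
  refine nonneg_of_heat_supersolution (r₁ := 1) (a := 0) (b := Real.pi / 2) h0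
    (continuousOn_W.mono (prod_mono (Icc_subset_Icc_left h0.le) (subset_univ _)))
    (fun s hs φ _ => hasDerivAt_W_radius (habs s hs) φ)
    (fun s hs φ _ => hasDerivAt_W_angle (habs s hs) φ)
    (fun s hs φ _ => hasDerivAt_Wt_angle (habs s hs) φ)
    (fun s _ φ _ => (add_neg_cancel _).le) (fun φ hφ => ?_) (fun s _ => (W_zero_angle s).ge)
    (fun s _ => (W_pi_div_two s).ge) r ⟨le_rfl, hr.2⟩ θ hθ
  rw [(W_one_and_Wt_one hφ).1]
  linarith [one_le_cos_add_sin hφ]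

/-- At an interior angle, `W(r, θ)` exceeds its linear approximation `r (cos θ + sin θ) - 1` by at
most `O((1 - r) ^ 2)`. The proof compares the difference with a quartic polynomial supersolution. -/
lemma W_le_of_half_le {r θ d : ℝ} (hd : 0 < d) (hr : r ∈ Icc (1 / 2 : ℝ) 1) (h1 : d ≤ θ)
    (h2 : d ≤ Real.pi / 2 - θ) :
    W r θ ≤ r * (Real.cos θ + Real.sin θ) - 1 + 2 * (1 - r) ^ 2 / d ^ 2 := by
  have habs : ∀ s ∈ Ico (1 / 2 : ℝ) 1, |s| < 1 := fun s hs => by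
    rw [abs_of_nonneg (by linarith [hs.1])]; exact hs.2
  have hcmp := nonneg_of_heat_supersolution (r₀ := 1 / 2) (r₁ := 1) (a := 0)
    (b := Real.pi / 2) (by norm_num)
    (h := fun s φ => ((φ - θ) ^ 4 + 24 * (φ - θ) ^ 2 * (1 - s) + 48 * (1 - s) ^ 2) / (24 * d ^ 2) -
      W s φ + s * (Real.cos φ + Real.sin φ) - 1)
    (hr := fun s φ => (-24 * (φ - θ) ^ 2 - 96 * (1 - s)) / (24 * d ^ 2) -
      Wr s φ + (Real.cos φ + Real.sin φ))
    (hθ := fun s φ => (4 * (φ - θ) ^ 3 + 48 * (φ - θ) * (1 - s)) / (24 * d ^ 2) -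
      Wt s φ + s * (-Real.sin φ + Real.cos φ))
    (hθθ := fun s φ => (12 * (φ - θ) ^ 2 + 48 * (1 - s)) / (24 * d ^ 2) -
      (-(s * Wr s φ)) + s * (-Real.cos φ + -Real.sin φ))
    ?_ ?_ ?_ ?_ ?_ ?_ ?_ ?_ r hr θ ⟨by linarith, by linarith⟩
  · have e : ((θ - θ) ^ 4 + 24 * (θ - θ) ^ 2 * (1 - r) + 48 * (1 - r) ^ 2) / (24 * d ^ 2) =
      2 * (1 - r) ^ 2 / d ^ 2 := by
      field_simp
      ring
    rw [e] at hcmp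
    linarith
  · have hW := continuousOn_W.mono (t := Icc (1 / 2 : ℝ) 1 ×ˢ Icc 0 (Real.pi / 2))
      (prod_mono (Icc_subset_Icc_left (by norm_num : (0 : ℝ) ≤ 1 / 2)) (subset_univ _))
    fun_prop
  · intro s hs φ _
    have hx : HasDerivAt (fun s : ℝ => 1 - s) (-1) s := (hasDerivAt_id s).const_sub 1
    convert! ((((((hx.const_mul (24 * (φ - θ) ^ 2)).const_add ((φ - θ) ^ 4)).add
      ((hx.pow 2).const_mul 48)).div_const (24 * d ^ 2)).sub
      (hasDerivAt_W_radius (habs s hs) φ)).add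
      ((hasDerivAt_id s).mul_const (Real.cos φ + Real.sin φ))).sub_const 1 using 1
    simp
    ring
  · intro s hs φ _
    have hx : HasDerivAt (fun φ : ℝ => φ - θ) 1 φ := (hasDerivAt_id φ).sub_const θ
    convert! ((((((hx.pow 4).add (((hx.pow 2).const_mul 24).mul_const (1 - s))).add_const
      (48 * (1 - s) ^ 2)).div_const (24 * d ^ 2)).sub
      (hasDerivAt_W_angle (habs s hs) φ)).add
      (((Real.hasDerivAt_cos φ).add (Real.hasDerivAt_sin φ)).const_mul s)).sub_const 1 using 1
    simp
    ring
  · intro s hs φ _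
    have hx : HasDerivAt (fun φ : ℝ => φ - θ) 1 φ := (hasDerivAt_id φ).sub_const θ
    convert! (((((hx.pow 3).const_mul 4).add ((hx.const_mul 48).mul_const (1 - s))).div_const
      (24 * d ^ 2)).sub (hasDerivAt_Wt_angle (habs s hs) φ)).add
      (((Real.hasDerivAt_sin φ).neg.add (Real.hasDerivAt_cos φ)).const_mul s) using 1
    simp
    ring
  · intro s hs φ _
    have e : s * ((-24 * (φ - θ) ^ 2 - 96 * (1 - s)) / (24 * d ^ 2) -
        Wr s φ + (Real.cos φ + Real.sin φ)) + ((12 * (φ - θ) ^ 2 + 48 * (1 - s)) / (24 * d ^ 2) -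
        (-(s * Wr s φ)) + s * (-Real.cos φ + -Real.sin φ)) =
        -((2 * s - 1) * (12 * (φ - θ) ^ 2 + 48 * (1 - s)) / (24 * d ^ 2)) := by ring
    rw [e, neg_nonpos]
    have h1 : 0 ≤ 2 * s - 1 := by linarith [hs.1]
    have h2 : 0 ≤ 1 - s := by linarith [hs.2]
    positivity
  · intro φ hφ
    rw [(W_one_and_Wt_one hφ).1]
    have : 0 ≤ ((φ - θ) ^ 4 + 24 * (φ - θ) ^ 2 * (1 - 1) + 48 * (1 - 1) ^ 2) / (24 * d ^ 2) := by
      simp only [sub_self, mul_zero, add_zero, ne_eq, OfNat.ofNat_ne_zero, not_false_eq_true,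
        zero_pow]
      positivity
    linarith
  · intro s hs
    have hξ : 0 ≤ 1 - s := by linarith [hs.2]
    have : 1 - s ≤
        ((0 - θ) ^ 4 + 24 * (0 - θ) ^ 2 * (1 - s) + 48 * (1 - s) ^ 2) / (24 * d ^ 2) := by
      rw [le_div_iff₀ (by positivity)]
      have e : d ^ 2 ≤ θ ^ 2 := by gcongr
      nlinarith [mul_nonneg hξ (sub_nonneg.2 e), pow_nonneg (hd.le.trans h1) 4, sq_nonneg (1 - s)]
    simp only [W_zero_angle, Real.cos_zero, Real.sin_zero]
    linarith
  · intro s hs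
    have hξ : 0 ≤ 1 - s := by linarith [hs.2]
    have : 1 - s ≤ ((Real.pi / 2 - θ) ^ 4 + 24 * (Real.pi / 2 - θ) ^ 2 * (1 - s) +
        48 * (1 - s) ^ 2) / (24 * d ^ 2) := by
      rw [le_div_iff₀ (by positivity)]
      have e : d ^ 2 ≤ (Real.pi / 2 - θ) ^ 2 := by gcongr
      nlinarith [mul_nonneg hξ (sub_nonneg.2 e), pow_nonneg (hd.le.trans h2) 4, sq_nonneg (1 - s)]
    simp only [W_pi_div_two, Real.cos_pi_div_two, Real.sin_pi_div_two]
    linarith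

/-- Near the corner `(1, 0)` the potential grows at least like `(1 - ε) θ`, since
`W_θ(1, 0) = 1`. -/
lemma exists_mul_le_W {ε : ℝ} (hε : 0 < ε) :
    ∃ η ∈ Ioo (0 : ℝ) 1, ∀ r ∈ Icc (1 - η) 1, ∀ θ ∈ Icc 0 η, (1 - ε) * θ ≤ W r θ := by
  have h11 : ((1 : ℝ), (0 : ℝ)) ∈ Icc (0 : ℝ) 1 ×ˢ (univ : Set ℝ) :=
    ⟨⟨zero_le_one, le_rfl⟩, mem_univ _⟩
  have hv : Wt 1 0 = 1 := by
    rw [(W_one_and_Wt_one ⟨le_rfl, by positivity⟩).2]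
    simp
  have hev := (continuousOn_Wt (1, 0) h11).eventually (lt_mem_nhds (a := 1 - ε) (by
    simp only [hv]; linarith))
  rw [eventually_nhdsWithin_iff, Metric.eventually_nhds_iff] at hev
  obtain ⟨δ, hδ, hev⟩ := hev
  refine ⟨min (δ / 2) (1 / 2), ⟨by positivity, by
    linarith [min_le_right (δ / 2) (1 / 2 : ℝ)]⟩, fun r hr θ hθ => ?_⟩
  have m1 := min_le_left (δ / 2) (1 / 2 : ℝ)
  have m2 := min_le_right (δ / 2) (1 / 2 : ℝ)
  have hr01 : r ∈ Icc (0 : ℝ) 1 := ⟨by linarith [hr.1], hr.2⟩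
  rcases hθ.1.eq_or_lt with rfl | hpos
  · rw [W_zero_angle, mul_zero]
  obtain ⟨c, hc, hslope⟩ := exists_hasDerivAt_eq_slope (fun s => W r s) (fun s => Wt r s) hpos
    (fun s _ => (hasDerivAt_W_angle_of_mem_Icc hr01 s).continuousAt.continuousWithinAt)
    fun s _ => hasDerivAt_W_angle_of_mem_Icc hr01 s
  have hlt : 1 - ε < Wt r c := by
    refine hev (y := (r, c)) ?_ ⟨hr01, mem_univ _⟩
    rw [Prod.dist_eq, max_lt_iff, Real.dist_eq, Real.dist_eq, abs_lt, abs_lt]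
    have := hc.1
    have := hc.2
    have := hθ.2
    have := hr.1
    have := hr.2
    refine ⟨⟨?_, ?_⟩, ⟨?_, ?_⟩⟩ <;> simp only <;> linarith
  rw [hslope, lt_div_iff₀ (by linarith), W_zero_angle] at hlt
  linarith

/-! ### The maximum over the radius -/

lemma continuousOn_objective_radius (x : Fin 2 → ℝ) (θ : ℝ) :
    ContinuousOn (fun r => objective x r θ) (Icc 0 1) := by
  have : ContinuousOn (fun r => W r θ) (Icc 0 1) :=
    continuousOn_W.comp (f := fun r : ℝ => (r, θ)) (by fun_prop) fun r hr => ⟨hr, mem_univ _⟩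
  unfold objective
  fun_prop

lemma bddAbove_objective (x : Fin 2 → ℝ) (θ : ℝ) :
    BddAbove (range fun r : Icc (0 : ℝ) 1 => objective x r θ) := by
  have := (isCompact_Icc.bddAbove_image (continuousOn_objective_radius x θ))
  rwa [image_eq_range] at this

lemma objective_le_maxOverRadius (x : Fin 2 → ℝ) {r : ℝ} (hr : r ∈ Icc (0 : ℝ) 1) (θ : ℝ) :
    objective x r θ ≤ maxOverRadius x θ :=
  le_ciSup (bddAbove_objective x θ) ⟨r, hr⟩

lemma maxOverRadius_eq {x : Fin 2 → ℝ} {r θ : ℝ} (hr : r ∈ Icc (0 : ℝ) 1)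
    (h : IsMaxOn (fun r => objective x r θ) (Icc 0 1) r) : maxOverRadius x θ = objective x r θ := by
  have : Nonempty (Icc (0 : ℝ) 1) := ⟨⟨r, hr⟩⟩
  exact le_antisymm (ciSup_le fun s => h s.2) (objective_le_maxOverRadius x hr θ)

lemma exists_isMaxOn_objective (x : Fin 2 → ℝ) (θ : ℝ) :
    ∃ r ∈ Icc (0 : ℝ) 1, IsMaxOn (fun r => objective x r θ) (Icc 0 1) r :=
  isCompact_Icc.exists_isMaxOn ⟨0, le_rfl, zero_le_one⟩ (continuousOn_objective_radius x θ)

lemma hasDerivAt_objective_radius (x : Fin 2 → ℝ) {r : ℝ} (hr : |r| < 1) (θ : ℝ) :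
    HasDerivAt (fun s => objective x s θ)
      (x 0 * Real.cos θ + x 1 * Real.sin θ - Wr r θ) r := by
  have := ((hasDerivAt_id r).mul_const (x 0 * Real.cos θ + x 1 * Real.sin θ)).sub
    (hasDerivAt_W_radius hr θ)
  simpa [objective] using! this

lemma cos_pos_of_mem {θ : ℝ} (hθ : θ ∈ Ioo 0 (Real.pi / 2)) : 0 < Real.cos θ :=
  Real.cos_pos_of_mem_Ioo ⟨by linarith [hθ.1, Real.pi_pos], hθ.2⟩

lemma sin_pos_of_mem {θ : ℝ} (hθ : θ ∈ Ioo 0 (Real.pi / 2)) : 0 < Real.sin θ :=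
  Real.sin_pos_of_pos_of_lt_pi hθ.1 (by linarith [hθ.2, Real.pi_pos])

/-- At an interior angle the maximum over the radius is not attained at `r = 0`, where
`∂f/∂r > 0`, nor at `r = 1`, where `W_r = cos θ + sin θ` exceeds `x cos θ + y sin θ`. -/
lemma mem_Ioo_of_isMaxOn {x : Fin 2 → ℝ} (hx : x ∈ Omega1) {r θ : ℝ}
    (hθ : θ ∈ Ioo 0 (Real.pi / 2)) (hr : r ∈ Icc (0 : ℝ) 1)
    (h : IsMaxOn (fun r => objective x r θ) (Icc 0 1) r) : r ∈ Ioo (0 : ℝ) 1 := by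
  obtain ⟨hx0, hx0', hx1, hx1'⟩ := hx
  have hcos := cos_pos_of_mem hθ
  have hsin := sin_pos_of_mem hθ
  refine ⟨lt_of_le_of_ne hr.1 ?_, lt_of_le_of_ne hr.2 ?_⟩
  · rintro rfl
    have hd := (hasDerivAt_objective_radius x (r := 0) (by simp) θ).hasDerivWithinAt (s := Ioi 0)
    have hW : Wr 0 θ = 0 := trigSeries_zero_radius _ (by norm_num) _ _
    rw [hW, sub_zero, hasDerivWithinAt_iff_tendsto_slope' self_notMem_Ioi] at hd
    have hpos : 0 < x 0 * Real.cos θ + x 1 * Real.sin θ := by positivity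
    obtain ⟨s, hs1, hs2⟩ := ((hd.eventually (lt_mem_nhds hpos)).and
      (Ioo_mem_nhdsGT zero_lt_one)).exists
    have hle := h (Ioo_subset_Icc_self hs2)
    simp only [mem_ofPred_eq] at hle
    rw [slope_def_field, lt_div_iff₀ (by linarith [hs2.1])] at hs1
    linarith
  · rintro rfl
    set κ := (1 - x 0) * Real.cos θ + (1 - x 1) * Real.sin θ with hκ
    have hκ0 : 0 < κ := add_pos (mul_pos (by linarith) hcos) (mul_pos (by linarith) hsin)
    set d := min θ (Real.pi / 2 - θ) with hd
    have hd0 : 0 < d := lt_min hθ.1 (by linarith [hθ.2])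
    have hd2 : 0 < d ^ 2 := by positivity
    -- a radius `1 - ξ` with `2 ξ ^ 2 / d ^ 2 < κ ξ`
    obtain ⟨ξ, hξ0, hξ1, hξ2⟩ : ∃ ξ : ℝ, 0 < ξ ∧ ξ ≤ 1 / 2 ∧ 2 * ξ < κ * d ^ 2 := by
      refine ⟨min (1 / 2) (κ * d ^ 2 / 4), by positivity, min_le_left _ _, ?_⟩
      have := min_le_right (1 / 2) (κ * d ^ 2 / 4)
      have : 0 < κ * d ^ 2 := by positivity
      linarith
    have hW := W_le_of_half_le (r := 1 - ξ) hd0 ⟨by linarith, by linarith⟩ (min_le_left _ _)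
      (min_le_right _ _)
    have hle := h (show 1 - ξ ∈ Icc (0 : ℝ) 1 from ⟨by linarith, by linarith⟩)
    simp only [mem_ofPred_eq, objective, (W_one_and_Wt_one (Ioo_subset_Icc_self hθ)).1] at hle
    have hq : 2 * (1 - (1 - ξ)) ^ 2 / d ^ 2 < ξ * κ := by
      rw [div_lt_iff₀ hd2]
      nlinarith [mul_pos hξ0 (sub_pos.2 hξ2)]
    nlinarith

lemma eq_Wr_of_isMaxOn {x : Fin 2 → ℝ} (hx : x ∈ Omega1) {r θ : ℝ}
    (hθ : θ ∈ Ioo 0 (Real.pi / 2)) (hr : r ∈ Icc (0 : ℝ) 1)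
    (h : IsMaxOn (fun r => objective x r θ) (Icc 0 1) r) :
    x 0 * Real.cos θ + x 1 * Real.sin θ = Wr r θ := by
  have hr' := mem_Ioo_of_isMaxOn hx hθ hr h
  have hmax : IsLocalMax (fun r => objective x r θ) r :=
    h.isLocalMax (Icc_mem_nhds hr'.1 hr'.2)
  have := hmax.hasDerivAt_eq_zero
    (hasDerivAt_objective_radius x (by rw [abs_of_pos hr'.1]; exact hr'.2) θ)
  linarith

lemma strictMonoOn_Wr {θ : ℝ} (hθ : θ ∈ Ioo 0 (Real.pi / 2)) :
    StrictMonoOn (fun r => Wr r θ) (Ioo 0 1) := by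
  have hd : ∀ r ∈ Ioo (0 : ℝ) 1, HasDerivAt (fun r => Wr r θ) (Wrr r θ) r := fun r hr =>
    hasDerivAt_Wr_radius (by rw [abs_of_pos hr.1]; exact hr.2) θ
  refine strictMonoOn_of_deriv_pos (convex_Ioo _ _)
    (fun r hr => (hd r hr).continuousAt.continuousWithinAt) fun r hr => ?_
  rw [interior_Ioo] at hr
  rw [(hd r hr).deriv]
  exact Wrr_pos hr hθ

/-- A maximizer of the objective function over `0 ≤ r ≤ 1`. -/
def bestRadius (x : Fin 2 → ℝ) (θ : ℝ) : ℝ := (exists_isMaxOn_objective x θ).choose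

lemma bestRadius_mem_Icc (x : Fin 2 → ℝ) (θ : ℝ) : bestRadius x θ ∈ Icc (0 : ℝ) 1 :=
  (exists_isMaxOn_objective x θ).choose_spec.1

lemma isMaxOn_bestRadius (x : Fin 2 → ℝ) (θ : ℝ) :
    IsMaxOn (fun r => objective x r θ) (Icc 0 1) (bestRadius x θ) :=
  (exists_isMaxOn_objective x θ).choose_spec.2

lemma maxOverRadius_eq_bestRadius (x : Fin 2 → ℝ) (θ : ℝ) :
    maxOverRadius x θ = objective x (bestRadius x θ) θ :=
  maxOverRadius_eq (bestRadius_mem_Icc x θ) (isMaxOn_bestRadius x θ)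

lemma bestRadius_mem_Ioo {x : Fin 2 → ℝ} (hx : x ∈ Omega1) {θ : ℝ}
    (hθ : θ ∈ Ioo 0 (Real.pi / 2)) : bestRadius x θ ∈ Ioo (0 : ℝ) 1 :=
  mem_Ioo_of_isMaxOn hx hθ (bestRadius_mem_Icc x θ) (isMaxOn_bestRadius x θ)

lemma eq_Wr_bestRadius {x : Fin 2 → ℝ} (hx : x ∈ Omega1) {θ : ℝ}
    (hθ : θ ∈ Ioo 0 (Real.pi / 2)) :
    x 0 * Real.cos θ + x 1 * Real.sin θ = Wr (bestRadius x θ) θ :=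
  eq_Wr_of_isMaxOn hx hθ (bestRadius_mem_Icc x θ) (isMaxOn_bestRadius x θ)

lemma eq_bestRadius {x : Fin 2 → ℝ} (hx : x ∈ Omega1) {r θ : ℝ}
    (hθ : θ ∈ Ioo 0 (Real.pi / 2)) (hr : r ∈ Ioo (0 : ℝ) 1)
    (h : x 0 * Real.cos θ + x 1 * Real.sin θ = Wr r θ) : r = bestRadius x θ :=
  (strictMonoOn_Wr hθ).injOn hr (bestRadius_mem_Ioo hx hθ)
    (h.symm.trans (eq_Wr_bestRadius hx hθ))

lemma hasDerivAt_comp_pair {F : ℝ × ℝ → ℝ} {f g : ℝ → ℝ} {a b f' g' t : ℝ}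
    (hF : HasFDerivAt F (a • ContinuousLinearMap.fst ℝ ℝ ℝ + b • ContinuousLinearMap.snd ℝ ℝ ℝ)
      (f t, g t)) (hf : HasDerivAt f f' t) (hg : HasDerivAt g g' t) :
    HasDerivAt (fun s => F (f s, g s)) (a * f' + b * g') t := by
  simpa using! HasFDerivAt.comp_hasDerivAt (f := fun s => (f s, g s)) t hF (hf.prodMk hg)

/-- The maximizing radius depends differentiably on the angle, by the implicit function theorem
and `W_rr ≠ 0`. -/
lemma exists_hasDerivAt_bestRadius {x : Fin 2 → ℝ} (hx : x ∈ Omega1) {θ : ℝ}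
    (hθ : θ ∈ Ioo 0 (Real.pi / 2)) :
    ∃ c, HasDerivAt (bestRadius x) c θ ∧
      x 1 * Real.cos θ - x 0 * Real.sin θ - Wrt (bestRadius x θ) θ =
        Wrr (bestRadius x θ) θ * c := by
  set r := bestRadius x θ with hr
  have hrI : r ∈ Ioo (0 : ℝ) 1 := bestRadius_mem_Ioo hx hθ
  have habs : |r| < 1 := by rw [abs_of_pos hrI.1]; exact hrI.2
  have hpos := Wrr_pos hrI hθ
  set F : ℝ × ℝ → ℝ := fun p => x 0 * Real.cos p.1 + x 1 * Real.sin p.1 - Wr p.2 p.1 with hF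
  have hd : ∀ φ, HasStrictDerivAt (fun φ => x 0 * Real.cos φ + x 1 * Real.sin φ)
      (x 1 * Real.cos φ - x 0 * Real.sin φ) φ := fun φ => by
    convert! ((Real.hasStrictDerivAt_cos φ).const_mul (x 0)).add
      ((Real.hasStrictDerivAt_sin φ).const_mul (x 1)) using 1
    ring
  have hswap : HasStrictFDerivAt (fun p : ℝ × ℝ => (p.2, p.1))
      ((ContinuousLinearMap.snd ℝ ℝ ℝ).prod (ContinuousLinearMap.fst ℝ ℝ ℝ)) (θ, r) :=
    hasStrictFDerivAt_snd.prodMk hasStrictFDerivAt_fst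
  set L : ℝ × ℝ →L[ℝ] ℝ := (x 1 * Real.cos θ - x 0 * Real.sin θ - Wrt r θ) •
    ContinuousLinearMap.fst ℝ ℝ ℝ - Wrr r θ • ContinuousLinearMap.snd ℝ ℝ ℝ with hL
  have hFd : HasStrictFDerivAt F L (θ, r) := by
    convert! ((hd θ).hasStrictFDerivAt.comp (θ, r) hasStrictFDerivAt_fst).sub
      ((hasStrictFDerivAt_Wr habs θ).comp (θ, r) hswap) using 1
    ext <;> simp [hL]
  have hinv : (L ∘L .inr ℝ ℝ ℝ).IsInvertible :=
    ⟨ContinuousLinearEquiv.unitsEquivAut ℝ (Units.mk0 (-Wrr r θ) (neg_ne_zero.2 hpos.ne')), by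
      ext
      simp [hL]⟩
  set ψ := hFd.implicitFunctionOfProdDomain hinv with hψ
  have h1 : Tendsto ψ (𝓝 θ) (𝓝 r) := hFd.tendsto_implicitFunctionOfProdDomain hinv
  have h2 : ∀ᶠ φ in 𝓝 θ, F (φ, ψ φ) = F (θ, r) :=
    hFd.eventually_apply_implicitFunctionOfProdDomain hinv
  have h3 := (hFd.hasStrictFDerivAt_implicitFunctionOfProdDomain hinv).hasFDerivAt.hasDerivAt
  have hF0 : F (θ, r) = 0 := sub_eq_zero.2 (eq_Wr_bestRadius hx hθ)
  have heq : bestRadius x =ᶠ[𝓝 θ] ψ := by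
    filter_upwards [h2, h1.eventually (Ioo_mem_nhds hrI.1 hrI.2), Ioo_mem_nhds hθ.1 hθ.2]
      with φ e1 e2 e3
    rw [hF0] at e1
    exact (eq_bestRadius hx e3 e2 (sub_eq_zero.1 e1)).symm
  have h4 := h3.congr_of_eventuallyEq heq
  refine ⟨_, h4, ?_⟩
  -- differentiate the equation satisfied by the maximizing radius
  have h5 := hasDerivAt_comp_pair (f := bestRadius x) (g := fun φ => φ)
    (hasStrictFDerivAt_Wr habs θ).hasFDerivAt h4 (hasDerivAt_id θ)
  have h6 : (fun φ => x 0 * Real.cos φ + x 1 * Real.sin φ) =ᶠ[𝓝 θ]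
      fun φ => Wr (bestRadius x φ) φ := by
    filter_upwards [Ioo_mem_nhds hθ.1 hθ.2] with φ hφ using eq_Wr_bestRadius hx hφ
  have h7 := (hd θ).hasDerivAt.unique (h5.congr_of_eventuallyEq h6)
  rw [h7, mul_one, add_sub_cancel_right]

/-! ### The minimum over the angle -/

/-- The derivative of `maxOverRadius` at an interior angle, by the envelope theorem: the partial
derivative `∂f/∂θ` at the maximizing radius. -/
def envelopeDeriv (x : Fin 2 → ℝ) (θ : ℝ) : ℝ :=
  bestRadius x θ * (x 1 * Real.cos θ - x 0 * Real.sin θ) - Wt (bestRadius x θ) θ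

lemma hasDerivAt_linear_angle (x : Fin 2 → ℝ) (θ : ℝ) :
    HasDerivAt (fun φ => x 0 * Real.cos φ + x 1 * Real.sin φ)
      (x 1 * Real.cos θ - x 0 * Real.sin θ) θ := by
  convert! ((Real.hasDerivAt_cos θ).const_mul (x 0)).add
    ((Real.hasDerivAt_sin θ).const_mul (x 1)) using 1
  ring

lemma hasDerivAt_maxOverRadius {x : Fin 2 → ℝ} (hx : x ∈ Omega1) {θ : ℝ}
    (hθ : θ ∈ Ioo 0 (Real.pi / 2)) :
    HasDerivAt (maxOverRadius x) (envelopeDeriv x θ) θ := by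
  obtain ⟨c, hc, -⟩ := exists_hasDerivAt_bestRadius hx hθ
  have hrI := bestRadius_mem_Ioo hx hθ
  have habs : |bestRadius x θ| < 1 := by rw [abs_of_pos hrI.1]; exact hrI.2
  have h := (hc.mul (hasDerivAt_linear_angle x θ)).sub
    (hasDerivAt_comp_pair (g := fun φ => φ) (hasFDerivAt_W habs θ) hc (hasDerivAt_id θ))
  have e : maxOverRadius x = fun θ => objective x (bestRadius x θ) θ :=
    funext fun θ => maxOverRadius_eq_bestRadius x θ
  rw [e]
  convert! h using 1
  rw [envelopeDeriv, eq_Wr_bestRadius hx hθ]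
  ring

/-- The maximum over the radius is a convex function of the angle: since `f_θθ = -r f_r` vanishes at
the maximizing radius, its second derivative is `(f_rθ) ^ 2 / W_rr`. -/
lemma hasDerivAt_envelopeDeriv {x : Fin 2 → ℝ} (hx : x ∈ Omega1) {θ : ℝ}
    (hθ : θ ∈ Ioo 0 (Real.pi / 2)) :
    HasDerivAt (envelopeDeriv x)
      ((x 1 * Real.cos θ - x 0 * Real.sin θ - Wrt (bestRadius x θ) θ) ^ 2 /
        Wrr (bestRadius x θ) θ) θ := by
  obtain ⟨c, hc, hc'⟩ := exists_hasDerivAt_bestRadius hx hθ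
  have hrI := bestRadius_mem_Ioo hx hθ
  have habs : |bestRadius x θ| < 1 := by rw [abs_of_pos hrI.1]; exact hrI.2
  have hpos := Wrr_pos hrI hθ
  have hd : HasDerivAt (fun φ => x 1 * Real.cos φ - x 0 * Real.sin φ)
      (-(x 0 * Real.cos θ + x 1 * Real.sin θ)) θ := by
    convert! ((Real.hasDerivAt_cos θ).const_mul (x 1)).sub
      ((Real.hasDerivAt_sin θ).const_mul (x 0)) using 1
    ring
  have h := (hc.mul hd).sub
    (hasDerivAt_comp_pair (g := fun φ => φ) (hasFDerivAt_Wt habs θ) hc (hasDerivAt_id θ))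
  convert! h using 1
  have hA := eq_Wr_bestRadius hx hθ
  have e : (x 1 * Real.cos θ - x 0 * Real.sin θ - Wrt (bestRadius x θ) θ) ^ 2 /
      Wrr (bestRadius x θ) θ =
      c * (x 1 * Real.cos θ - x 0 * Real.sin θ - Wrt (bestRadius x θ) θ) := by
    rw [div_eq_iff hpos.ne', hc']
    ring
  rw [e, hA]
  ring

lemma envelopeDeriv_zero_unique {x : Fin 2 → ℝ} (hx : x ∈ Omega1) {θ₁ θ₂ : ℝ}
    (h1 : θ₁ ∈ Ioo 0 (Real.pi / 2)) (h2 : θ₂ ∈ Ioo 0 (Real.pi / 2))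
    (e1 : envelopeDeriv x θ₁ = 0) (e2 : envelopeDeriv x θ₂ = 0) : θ₁ = θ₂ := by
  by_contra hne
  wlog hlt : θ₁ < θ₂ generalizing θ₁ θ₂
  · exact this h2 h1 e2 e1 (Ne.symm hne) (lt_of_le_of_ne (not_lt.1 hlt) (Ne.symm hne))
  have hmono : MonotoneOn (envelopeDeriv x) (Ioo 0 (Real.pi / 2)) := by
    refine monotoneOn_of_deriv_nonneg (convex_Ioo _ _)
      (fun θ hθ => (hasDerivAt_envelopeDeriv hx hθ).continuousAt.continuousWithinAt)
      (fun θ hθ => ?_) fun θ hθ => ?_ <;> rw [interior_Ioo] at hθ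
    · exact (hasDerivAt_envelopeDeriv hx hθ).differentiableAt.differentiableWithinAt
    · rw [(hasDerivAt_envelopeDeriv hx hθ).deriv]
      exact div_nonneg (sq_nonneg _) (Wrr_pos (bestRadius_mem_Ioo hx hθ) hθ).le
  -- between two zeros the derivative vanishes identically, and so does its own derivative
  obtain ⟨θ, ⟨hθ1, hθ2⟩, hθ4⟩ : ∃ θ ∈ Ioo θ₁ θ₂, θ ≠ Real.pi / 4 := by
    by_cases h : (θ₁ + θ₂) / 2 = Real.pi / 4
    · exact ⟨(3 * θ₁ + θ₂) / 4, ⟨by linarith, by linarith⟩, by intro h'; linarith⟩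
    · exact ⟨_, ⟨by linarith, by linarith⟩, h⟩
  have hsub : ∀ φ ∈ Ioo θ₁ θ₂, φ ∈ Ioo 0 (Real.pi / 2) := fun φ hφ =>
    ⟨h1.1.trans hφ.1, hφ.2.trans h2.2⟩
  have hzero : ∀ φ ∈ Ioo θ₁ θ₂, envelopeDeriv x φ = 0 := fun φ hφ =>
    le_antisymm (e2 ▸ hmono (hsub φ hφ) h2 hφ.2.le) (e1 ▸ hmono h1 (hsub φ hφ) hφ.1.le)
  have hθ := hsub θ ⟨hθ1, hθ2⟩
  have hev : envelopeDeriv x =ᶠ[𝓝 θ] fun _ => 0 := by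
    filter_upwards [Ioo_mem_nhds hθ1 hθ2] with φ hφ using hzero φ hφ
  have hd := (hasDerivAt_envelopeDeriv hx hθ).unique
    ((hasDerivAt_const θ (0 : ℝ)).congr_of_eventuallyEq hev)
  have hrI := bestRadius_mem_Ioo hx hθ
  rw [div_eq_zero_iff, or_iff_left (Wrr_pos hrI hθ).ne', sq_eq_zero_iff] at hd
  have hz : bestRadius x θ * (x 1 * Real.cos θ - x 0 * Real.sin θ) - Wt (bestRadius x θ) θ = 0 :=
    hzero θ ⟨hθ1, hθ2⟩
  refine mul_Wrt_sub_Wt_ne_zero hrI hθ hθ4 ?_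
  linear_combination hz - bestRadius x θ * hd

/-- The minimum over the angle is not attained at `θ = 0`. -/
lemma exists_maxOverRadius_lt {x : Fin 2 → ℝ} (hx : x ∈ Omega1) :
    ∃ θ ∈ Ioo 0 (Real.pi / 2), maxOverRadius x θ < x 0 := by
  obtain ⟨hx0, hx0', hx1, hx1'⟩ := hx
  obtain ⟨η, ⟨hη0, hη1⟩, hη⟩ := exists_mul_le_W (ε := (1 - x 1) / 2) (by linarith)
  have hpi := Real.pi_gt_three
  have hx0η : 0 < η * x 0 := mul_pos hη0 hx0
  set θ := η * x 0 / 2 with hθdef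
  have hθ0 : 0 < θ := by positivity
  have hθη : θ ≤ η := by nlinarith
  have hθI : θ ∈ Ioo 0 (Real.pi / 2) := ⟨hθ0, by linarith⟩
  refine ⟨θ, hθI, ?_⟩
  obtain ⟨r, hr, hmax⟩ := exists_isMaxOn_objective x θ
  rw [maxOverRadius_eq hr hmax]
  have hlin : x 0 * Real.cos θ + x 1 * Real.sin θ ≤ x 0 + x 1 * θ :=
    add_le_add (mul_le_of_le_one_right hx0.le (Real.cos_le_one θ))
      (mul_le_mul_of_nonneg_left (Real.sin_le hθ0.le) hx1.le)
  have hmul := mul_le_mul_of_nonneg_left hlin hr.1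
  unfold objective
  rcases le_total r (1 - η) with h | h
  · have hW := W_nonneg hr (Ioo_subset_Icc_self hθI)
    have h2 : r * (x 0 + x 1 * θ) ≤ (1 - η) * (x 0 + x 1 * θ) := by gcongr
    have h3 : x 1 * θ < θ := mul_lt_of_lt_one_left hθ0 hx1'
    nlinarith [mul_pos hη0 (mul_pos hx1 hθ0)]
  · have hW := hη r ⟨h, hr.2⟩ θ ⟨hθ0.le, hθη⟩
    have h2 : r * (x 0 + x 1 * θ) ≤ 1 * (x 0 + x 1 * θ) :=
      mul_le_mul_of_nonneg_right hr.2 (by positivity)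
    nlinarith

lemma maxOverRadius_reflect (x : Fin 2 → ℝ) (θ : ℝ) :
    maxOverRadius ![x 1, x 0] (Real.pi / 2 - θ) = maxOverRadius x θ := by
  unfold maxOverRadius objective
  congr 1 with r
  rw [W_reflect, Real.cos_pi_div_two_sub, Real.sin_pi_div_two_sub]
  simp only [Matrix.cons_val_zero, Matrix.cons_val_one]
  rw [add_comm]

lemma exists_maxOverRadius_lt' {x : Fin 2 → ℝ} (hx : x ∈ Omega1) :
    ∃ θ ∈ Ioo 0 (Real.pi / 2), maxOverRadius x θ < x 1 := by
  obtain ⟨θ, hθ, h⟩ := exists_maxOverRadius_lt (x := ![x 1, x 0])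
    ⟨hx.2.2.1, hx.2.2.2, hx.1, hx.2.1⟩
  refine ⟨Real.pi / 2 - θ, ⟨by linarith [hθ.2], by linarith [hθ.1]⟩, ?_⟩
  rw [← maxOverRadius_reflect, sub_sub_cancel]
  simpa using h

lemma exists_isMinOn_maxOverRadius (x : Fin 2 → ℝ) :
    ∃ θ ∈ Icc 0 (Real.pi / 2), IsMinOn (maxOverRadius x) (Icc 0 (Real.pi / 2)) θ := by
  refine LowerSemicontinuousOn.exists_isMinOn ⟨0, le_rfl, by positivity⟩ isCompact_Icc
    (lowerSemicontinuousOn_ciSup (fun θ _ => bddAbove_objective x θ) fun r => ?_)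
  have hW : Continuous (fun θ => W r θ) :=
    continuousOn_W.comp_continuous (f := fun θ : ℝ => ((r : ℝ), θ)) (by fun_prop)
      fun θ => ⟨r.2, mem_univ _⟩
  refine (Continuous.lowerSemicontinuous ?_).lowerSemicontinuousOn _
  unfold objective
  fun_prop

lemma mem_Ioo_of_isMinOn {x : Fin 2 → ℝ} (hx : x ∈ Omega1) {θ : ℝ}
    (hθ : θ ∈ Icc 0 (Real.pi / 2)) (h : IsMinOn (maxOverRadius x) (Icc 0 (Real.pi / 2)) θ) :
    θ ∈ Ioo 0 (Real.pi / 2) := by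
  have h11 : (1 : ℝ) ∈ Icc (0 : ℝ) 1 := ⟨zero_le_one, le_rfl⟩
  refine ⟨lt_of_le_of_ne hθ.1 ?_, lt_of_le_of_ne hθ.2 ?_⟩
  · rintro rfl
    obtain ⟨φ, hφ, hlt⟩ := exists_maxOverRadius_lt hx
    have h1 : maxOverRadius x 0 ≤ maxOverRadius x φ := h (Ioo_subset_Icc_self hφ)
    have h2 := objective_le_maxOverRadius x h11 0
    simp only [objective, W_zero_angle, Real.cos_zero, Real.sin_zero] at h2
    linarith
  · rintro rfl
    obtain ⟨φ, hφ, hlt⟩ := exists_maxOverRadius_lt' hx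
    have h1 : maxOverRadius x (Real.pi / 2) ≤ maxOverRadius x φ := h (Ioo_subset_Icc_self hφ)
    have h2 := objective_le_maxOverRadius x h11 (Real.pi / 2)
    simp only [objective, W_pi_div_two, Real.cos_pi_div_two, Real.sin_pi_div_two] at h2
    linarith

/-- A critical point of the objective function in the open rectangle: `f_r = 0` and `f_θ = 0`, with
the derivatives of `W` written as series. -/
def IsCritical (x : Fin 2 → ℝ) (ρ : ℝ × ℝ) : Prop :=
  ρ ∈ D1 ∧ x 0 * Real.cos ρ.2 + x 1 * Real.sin ρ.2 = Wr ρ.1 ρ.2 ∧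
    ρ.1 * (x 1 * Real.cos ρ.2 - x 0 * Real.sin ρ.2) = Wt ρ.1 ρ.2

lemma IsMinimax.isCritical {x : Fin 2 → ℝ} (hx : x ∈ Omega1) {ρ : ℝ × ℝ} (h : IsMinimax x ρ) :
    IsCritical x ρ := by
  obtain ⟨hr, hθ, hmax, hmin⟩ := h
  have hθI := mem_Ioo_of_isMinOn hx hθ hmin
  have hrI := mem_Ioo_of_isMaxOn hx hθI hr hmax
  have hA := eq_Wr_of_isMaxOn hx hθI hr hmax
  refine ⟨⟨hrI, hθI⟩, hA, ?_⟩
  have hloc : IsLocalMin (maxOverRadius x) ρ.2 := hmin.isLocalMin (Icc_mem_nhds hθI.1 hθI.2)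
  have hz := hloc.hasDerivAt_eq_zero (hasDerivAt_maxOverRadius hx hθI)
  rw [envelopeDeriv, ← eq_bestRadius hx hθI hrI hA] at hz
  linarith

lemma IsCritical.unique {x : Fin 2 → ℝ} (hx : x ∈ Omega1) {ρ σ : ℝ × ℝ} (h1 : IsCritical x ρ)
    (h2 : IsCritical x σ) : ρ = σ := by
  have key : ∀ τ : ℝ × ℝ, IsCritical x τ → τ.1 = bestRadius x τ.2 ∧ envelopeDeriv x τ.2 = 0 := by
    rintro τ ⟨⟨hr, hθ⟩, hA, hB⟩
    have e := eq_bestRadius hx hθ hr hA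
    exact ⟨e, by rw [envelopeDeriv, ← e, hB, sub_self]⟩
  have e := envelopeDeriv_zero_unique hx h1.1.2 h2.1.2 (key ρ h1).2 (key σ h2).2
  exact Prod.ext (by rw [(key ρ h1).1, (key σ h2).1, e]) e

lemma exists_isMinimax (x : Fin 2 → ℝ) : ∃ ρ, IsMinimax x ρ := by
  obtain ⟨θ, hθ, hmin⟩ := exists_isMinOn_maxOverRadius x
  exact ⟨(bestRadius x θ, θ), bestRadius_mem_Icc x θ, hθ, isMaxOn_bestRadius x θ, hmin⟩

lemma isMinimax_minimaxPoint (x : Fin 2 → ℝ) : IsMinimax x (minimaxPoint x) :=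
  Classical.epsilon_spec (exists_isMinimax x)

lemma isCritical_minimaxPoint {x : Fin 2 → ℝ} (hx : x ∈ Omega1) :
    IsCritical x (minimaxPoint x) :=
  (isMinimax_minimaxPoint x).isCritical hx

lemma IsMinimax.eq_minimaxPoint {x : Fin 2 → ℝ} (hx : x ∈ Omega1) {ρ : ℝ × ℝ}
    (h : IsMinimax x ρ) : ρ = minimaxPoint x :=
  (h.isCritical hx).unique hx (isCritical_minimaxPoint hx)

lemma u_eq_objective (x : Fin 2 → ℝ) :
    u x = objective x (minimaxPoint x).1 (minimaxPoint x).2 := by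
  obtain ⟨hr, hθ, hmax, hmin⟩ := isMinimax_minimaxPoint x
  rw [← maxOverRadius_eq hr hmax]
  rw [isMinOn_iff] at hmin
  have : Nonempty (Icc 0 (Real.pi / 2)) := ⟨⟨_, hθ⟩⟩
  have hbdd : BddBelow (range fun θ : Icc 0 (Real.pi / 2) => maxOverRadius x θ) := by
    refine ⟨maxOverRadius x (minimaxPoint x).2, ?_⟩
    rintro _ ⟨θ, rfl⟩
    exact hmin θ θ.2
  exact le_antisymm (ciInf_le hbdd ⟨_, hθ⟩) (le_ciInf fun θ => hmin θ θ.2)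

/-! ### Analyticity of `w` -/

/-- The monomial `s ^ k z ^ (N - k)` on `ℂ × ℂ` as a multilinear map of degree `N`. -/
def monomialMap (N k : ℕ) : ContinuousMultilinearMap ℂ (fun _ : Fin N => ℂ × ℂ) ℂ :=
  (ContinuousMultilinearMap.mkPiAlgebra ℂ (Fin N) ℂ).compContinuousLinearMap
    fun i => if (i : ℕ) < k then ContinuousLinearMap.fst ℂ ℂ ℂ else ContinuousLinearMap.snd ℂ ℂ ℂ

lemma norm_monomialMap_le (N k : ℕ) : ‖monomialMap N k‖ ≤ 1 := by
  refine (ContinuousMultilinearMap.norm_compContinuousLinearMap_le _ _).trans ?_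
  rw [ContinuousMultilinearMap.norm_mkPiAlgebra, one_mul]
  refine Finset.prod_le_one (fun _ _ => norm_nonneg _) fun i _ => ?_
  split_ifs
  · exact ContinuousLinearMap.norm_fst_le ..
  · exact ContinuousLinearMap.norm_snd_le ..

lemma monomialMap_apply (a b : ℕ) (y : ℂ × ℂ) :
    monomialMap (a + b) a (fun _ => y) = y.1 ^ a * y.2 ^ b := by
  have h : monomialMap (a + b) a (fun _ => y) =
      ∏ i : Fin (a + b), if (i : ℕ) < a then y.1 else y.2 := by
    simp only [monomialMap, ContinuousMultilinearMap.compContinuousLinearMap_apply,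
      ContinuousMultilinearMap.mkPiAlgebra_apply]
    refine Finset.prod_congr rfl fun i _ => ?_
    split_ifs <;> rfl
  rw [h, Finset.prod_range (fun i : ℕ => if i < a then y.1 else y.2) |>.symm,
    Finset.prod_range_add]
  congr 1
  · rw [Finset.prod_congr rfl fun i hi => if_pos (Finset.mem_range.1 hi), Finset.prod_const,
      Finset.card_range]
  · rw [Finset.prod_congr rfl fun i _ => if_neg (by omega), Finset.prod_const, Finset.card_range]

/-- A sum of monomials of distinct degrees with bounded coefficients is analytic in the unit
bidisc. -/
lemma analyticOnNhd_tsum_monomial {c : ℕ → ℂ} {a b : ℕ → ℕ} (hc : ∀ n, ‖c n‖ ≤ 1)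
    (hinj : Function.Injective fun n => a n + b n) :
    AnalyticOnNhd ℂ (fun y : ℂ × ℂ => ∑' n, c n * (y.1 ^ a n * y.2 ^ b n)) (Metric.ball 0 1) := by
  classical
  set p : FormalMultilinearSeries ℂ (ℂ × ℂ) ℂ := fun N =>
    if h : ∃ n, a n + b n = N then c h.choose • monomialMap N (a h.choose) else 0 with hp
  have hpn (n : ℕ) : p (a n + b n) = c n • monomialMap (a n + b n) (a n) := by
    have h : ∃ n', a n' + b n' = a n + b n := ⟨n, rfl⟩
    have e : h.choose = n := hinj h.choose_spec
    simp only [hp, dif_pos h]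
    rw [e]
  have hp0 (N : ℕ) (h : N ∉ range fun n => a n + b n) : p N = 0 := by
    simp only [hp]
    exact dif_neg h
  have hnorm (N : ℕ) : ‖p N‖ ≤ 1 := by
    by_cases h : N ∈ range fun n => a n + b n
    · obtain ⟨n, rfl⟩ := h
      simp only [hpn, norm_smul]
      exact mul_le_one₀ (hc n) (norm_nonneg _) (norm_monomialMap_le _ _)
    · rw [hp0 N h, norm_zero]; exact zero_le_one
  have hrad : 1 ≤ p.radius := by
    have := p.le_radius_of_bound 1 (r := 1) fun N => by simpa using hnorm N
    simpa using this
  have hfps : HasFPowerSeriesOnBall (fun y : ℂ × ℂ => ∑' n, c n * (y.1 ^ a n * y.2 ^ b n)) p 0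
      1 := by
    refine ⟨hrad, one_pos, fun {y} hy => ?_⟩
    have hs := p.summable (x := y) (Metric.eball_subset_eball hrad hy)
    rw [zero_add]
    have e : (fun n => c n * (y.1 ^ a n * y.2 ^ b n)) =
        (fun N => p N fun _ => y) ∘ fun n => a n + b n := by
      funext n
      simp only [Function.comp_apply]
      rw [hpn, smul_apply, monomialMap_apply, smul_eq_mul]
    rw [← hinj.hasSum_iff (f := fun N => p N fun _ => y), ← e]
    · refine Summable.hasSum ?_
      rw [e]
      exact hs.comp_injective hinj
    · intro N hN
      rw [hp0 N hN]
      rfl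
  have := hfps.analyticOnNhd
  rwa [← ENNReal.ofReal_one, Metric.eball_ofReal] at this

lemma isOpen_B1 : IsOpen B1 := by
  have h : IsOpen {p : Fin 2 → ℝ | p 0 ^ 2 + p 1 ^ 2 < 1} :=
    isOpen_lt (by fun_prop) continuous_const
  exact (isOpen_lt continuous_const (continuous_apply 0)).inter
    ((isOpen_lt continuous_const (continuous_apply 1)).inter h)

lemma norm_mk_eq_sqrt (a b : ℝ) : ‖(⟨a, b⟩ : ℂ)‖ = √(a ^ 2 + b ^ 2) := by
  rw [Complex.norm_def, Complex.normSq_apply]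
  congr 1
  ring

/-- The term `r ^ (m ^ 2) sin (m θ)` is the imaginary part of `(r ^ 2) ^ ((m ^ 2 - m) / 2) z ^ m`,
where `z = r exp (i θ)`. -/
lemma norm_pow_mul_sin_freq (z : ℂ) (n : ℕ) :
    ‖z‖ ^ (freq n ^ 2) * Real.sin (freq n * Complex.arg z) =
      (((‖z‖ ^ 2 : ℝ) : ℂ) ^ ((2 * n + 1) * (4 * n + 1)) * z ^ freq n).im := by
  have e : z ^ freq n = ((‖z‖ ^ freq n : ℝ) : ℂ) *
      Complex.exp ((freq n * Complex.arg z : ℝ) * Complex.I) := by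
    conv_lhs => rw [← Complex.norm_mul_exp_arg_mul_I z, mul_pow, ← Complex.exp_nat_mul]
    push_cast
    ring_nf
  rw [e, ← Complex.ofReal_pow, Complex.im_ofReal_mul, Complex.im_ofReal_mul,
    Complex.exp_ofReal_mul_I_im, ← mul_assoc, ← pow_mul, ← pow_add]
  congr 2
  unfold freq
  ring

/-- The holomorphic extension of `w` in the variables `s = p ^ 2 + q ^ 2` and `z = p + i q`. -/
def wExt (y : ℂ × ℂ) : ℂ :=
  ∑' n : ℕ, ((1 / (((freq n : ℝ) ^ 2 - 1) * freq n) : ℝ) : ℂ) *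
    (y.1 ^ ((2 * n + 1) * (4 * n + 1)) * y.2 ^ freq n)

lemma norm_inv_coeff_le_one (n : ℕ) : ‖((1 / (((freq n : ℝ) ^ 2 - 1) * freq n) : ℝ) : ℂ)‖ ≤ 1 := by
  have h2 := two_le_freq n
  have h1 : 1 ≤ (freq n : ℝ) ^ 2 - 1 := by nlinarith
  rw [Complex.norm_real, Real.norm_of_nonneg (by positivity)]
  rw [div_le_one (by positivity)]
  nlinarith

lemma injective_degree : Function.Injective fun n : ℕ => (2 * n + 1) * (4 * n + 1) + freq n := by
  refine StrictMono.injective (strictMono_nat_of_lt_succ fun n => ?_)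
  unfold freq
  nlinarith

lemma analyticOnNhd_wExt : AnalyticOnNhd ℂ wExt (Metric.ball 0 1) :=
  analyticOnNhd_tsum_monomial norm_inv_coeff_le_one injective_degree

lemma w_eq_wExt {p : Fin 2 → ℝ} (hp : p 0 ^ 2 + p 1 ^ 2 < 1) :
    w p = 8 / Real.pi * (wExt (((p 0 ^ 2 + p 1 ^ 2 : ℝ) : ℂ), ⟨p 0, p 1⟩)).im := by
  set z : ℂ := ⟨p 0, p 1⟩ with hz
  have hn : ‖z‖ = √(p 0 ^ 2 + p 1 ^ 2) := norm_mk_eq_sqrt _ _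
  have hn2 : ‖z‖ ^ 2 = p 0 ^ 2 + p 1 ^ 2 := by rw [hn, Real.sq_sqrt (by positivity)]
  have hlt : ‖z‖ < 1 := by nlinarith [norm_nonneg z]
  have hsum : Summable fun n : ℕ => ((1 / (((freq n : ℝ) ^ 2 - 1) * freq n) : ℝ) : ℂ) *
      (((p 0 ^ 2 + p 1 ^ 2 : ℝ) : ℂ) ^ ((2 * n + 1) * (4 * n + 1)) * z ^ freq n) := by
    refine Summable.of_norm_bounded (summable_geometric_of_lt_one (norm_nonneg z) hlt) fun n => ?_
    have h1 : ‖((‖z‖ ^ 2 : ℝ) : ℂ) ^ ((2 * n + 1) * (4 * n + 1))‖ ≤ 1 := by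
      rw [norm_pow, Complex.norm_real, Real.norm_of_nonneg (by positivity)]
      exact pow_le_one₀ (by positivity) (pow_le_one₀ (norm_nonneg z) hlt.le)
    have h2 : ‖z ^ freq n‖ ≤ ‖z‖ ^ n := by
      rw [norm_pow]
      exact pow_le_pow_of_le_one (norm_nonneg z) hlt.le (by unfold freq; omega)
    rw [← hn2, norm_mul, norm_mul]
    calc _ ≤ 1 * (1 * ‖z‖ ^ n) :=
          mul_le_mul (norm_inv_coeff_le_one n) (mul_le_mul h1 h2 (norm_nonneg _) zero_le_one)
            (by positivity) zero_le_one
      _ = ‖z‖ ^ n := by ring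
  unfold w W
  rw [← hn]
  congr 1
  unfold wExt
  rw [← (Complex.hasSum_im hsum.hasSum).tsum_eq]
  congr 1 with n
  rw [Complex.im_ofReal_mul, ← hn2, ← norm_pow_mul_sin_freq]
  simp only [freq]
  ring

lemma analyticOnNhd_w : AnalyticOnNhd ℝ w B1 := by
  intro p hp
  have hlt : p 0 ^ 2 + p 1 ^ 2 < 1 := hp.2.2
  have e : w =ᶠ[𝓝 p] fun p => 8 / Real.pi *
      (wExt (((p 0 ^ 2 + p 1 ^ 2 : ℝ) : ℂ), ⟨p 0, p 1⟩)).im := by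
    filter_upwards [isOpen_B1.mem_nhds hp] with q hq using w_eq_wExt hq.2.2
  refine AnalyticAt.congr ?_ e.symm
  have h0 (i : Fin 2) : AnalyticAt ℝ (fun p : Fin 2 → ℝ => p i) p :=
    (ContinuousLinearMap.proj (R := ℝ) (φ := fun _ : Fin 2 => ℝ) i).analyticAt p
  have hof {f : (Fin 2 → ℝ) → ℝ} (hf : AnalyticAt ℝ f p) :
      AnalyticAt ℝ (fun p => (f p : ℂ)) p :=
    (Complex.ofRealCLM.analyticAt _).comp hf
  have h1 : AnalyticAt ℝ (fun p : Fin 2 → ℝ => ((p 0 ^ 2 + p 1 ^ 2 : ℝ) : ℂ)) p :=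
    hof (((h0 0).pow 2).add ((h0 1).pow 2))
  have h2 : AnalyticAt ℝ (fun p : Fin 2 → ℝ => (⟨p 0, p 1⟩ : ℂ)) p := by
    have : (fun p : Fin 2 → ℝ => (⟨p 0, p 1⟩ : ℂ)) =
        fun p => ((p 0 : ℝ) : ℂ) + ((p 1 : ℝ) : ℂ) * Complex.I := by
      funext p
      exact Complex.mk_eq_add_mul_I _ _
    rw [this]
    exact (hof (h0 0)).add ((hof (h0 1)).mul analyticAt_const)
  have hmem : ((((p 0 ^ 2 + p 1 ^ 2 : ℝ) : ℂ), (⟨p 0, p 1⟩ : ℂ)) : ℂ × ℂ) ∈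
      Metric.ball (0 : ℂ × ℂ) 1 := by
    rw [mem_ball_zero_iff, Prod.norm_def, max_lt_iff]
    refine ⟨?_, ?_⟩
    · rw [Complex.norm_real, Real.norm_of_nonneg (by positivity)]
      exact hlt
    · rw [norm_mk_eq_sqrt, Real.sqrt_lt' one_pos, one_pow]
      exact hlt
  have h3 : AnalyticAt ℝ wExt (((p 0 ^ 2 + p 1 ^ 2 : ℝ) : ℂ), (⟨p 0, p 1⟩ : ℂ)) :=
    (analyticOnNhd_wExt _ hmem).restrictScalars
  have h4 := h3.comp₂ h1 h2
  exact analyticAt_const.mul ((Complex.imCLM.analyticAt _).comp h4)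

/-! ### The Hessian matrix of `w` in polar coordinates -/

lemma W_eq_w_polarMap {r θ : ℝ} (hr : 0 < r) (hθ : θ ∈ Ioo 0 (Real.pi / 2)) :
    w (polarMap (r, θ)) = W r θ := by
  have hz : (⟨polarMap (r, θ) 0, polarMap (r, θ) 1⟩ : ℂ) =
      r * (Complex.cos θ + Complex.sin θ * Complex.I) := by
    rw [Complex.mk_eq_add_mul_I]
    simp only [polarMap, Matrix.cons_val_zero, Matrix.cons_val_one]
    push_cast
    ring
  unfold w
  rw [← norm_mk_eq_sqrt, hz, Complex.arg_mul_cos_add_sin_mul_I hr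
    ⟨by linarith [hθ.1, Real.pi_pos], by linarith [hθ.2, Real.pi_pos]⟩, norm_mul,
    Complex.norm_cos_add_sin_mul_I, mul_one, Complex.norm_real, Real.norm_of_nonneg hr.le]

lemma polarMap_mem_B1 {ρ : ℝ × ℝ} (hρ : ρ ∈ D1) : polarMap ρ ∈ B1 := by
  obtain ⟨hr, hθ⟩ := hρ
  refine ⟨mul_pos hr.1 (cos_pos_of_mem hθ), mul_pos hr.1 (sin_pos_of_mem hθ), ?_⟩
  have : polarMap ρ 0 ^ 2 + polarMap ρ 1 ^ 2 = ρ.1 ^ 2 := by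
    simp only [polarMap, Matrix.cons_val_zero, Matrix.cons_val_one]
    linear_combination ρ.1 ^ 2 * Real.sin_sq_add_cos_sq ρ.2
  rw [this]
  exact pow_lt_one₀ hr.1.le hr.2 two_ne_zero

lemma exists_polarMap_eq {p : Fin 2 → ℝ} (hp : p ∈ B1) : ∃ ρ ∈ D1, polarMap ρ = p := by
  obtain ⟨h0, h1, hlt⟩ := hp
  set z : ℂ := ⟨p 0, p 1⟩ with hz
  have hn : ‖z‖ = √(p 0 ^ 2 + p 1 ^ 2) := norm_mk_eq_sqrt _ _
  have hz0 : z ≠ 0 := fun h => h0.ne' (congrArg Complex.re h)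
  refine ⟨(‖z‖, Complex.arg z), ⟨⟨norm_pos_iff.2 hz0, ?_⟩, ⟨?_, ?_⟩⟩, ?_⟩
  · simp only [hn]
    rw [Real.sqrt_lt' one_pos, one_pow]
    exact hlt
  · refine lt_of_le_of_ne (Complex.arg_nonneg_iff.2 h1.le) fun h => ?_
    have := Complex.norm_mul_sin_arg z
    simp only at h
    rw [← h, Real.sin_zero, mul_zero] at this
    exact h1.ne this
  · exact (abs_lt.1 (Complex.abs_arg_lt_pi_div_two_iff.2 (Or.inl h0))).2
  · ext i
    fin_cases i
    · exact Complex.norm_mul_cos_arg z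
    · exact Complex.norm_mul_sin_arg z

lemma clm_apply_eq (L : (Fin 2 → ℝ) →L[ℝ] ℝ) (v : Fin 2 → ℝ) :
    L v = v 0 * L (Pi.single 0 1) + v 1 * L (Pi.single 1 1) := by
  have : v = v 0 • Pi.single 0 1 + v 1 • Pi.single 1 1 := by
    ext i
    fin_cases i <;> simp
  conv_lhs => rw [this]
  simp

lemma fderiv_apply_eq (v : (Fin 2 → ℝ) → ℝ) (x y : Fin 2 → ℝ) :
    fderiv ℝ v x y = y 0 * partialDeriv 0 v x + y 1 * partialDeriv 1 v x :=
  clm_apply_eq _ _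

lemma hasDerivAt_comp_polarMap_angle {v : (Fin 2 → ℝ) → ℝ} {r θ : ℝ}
    (hv : DifferentiableAt ℝ v (polarMap (r, θ))) :
    HasDerivAt (fun s => v (polarMap (r, s)))
      (-(r * Real.sin θ) * partialDeriv 0 v (polarMap (r, θ)) +
        r * Real.cos θ * partialDeriv 1 v (polarMap (r, θ))) θ := by
  have hpm : HasDerivAt (fun s => polarMap (r, s)) ![-(r * Real.sin θ), r * Real.cos θ] θ := by
    rw [hasDerivAt_pi]
    intro i
    fin_cases i
    · simpa [polarMap] using! (Real.hasDerivAt_cos θ).const_mul r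
    · simpa [polarMap] using! (Real.hasDerivAt_sin θ).const_mul r
  have := HasFDerivAt.comp_hasDerivAt (f := fun s => polarMap (r, s)) θ hv.hasFDerivAt hpm
  rw [fderiv_apply_eq] at this
  exact this

lemma hasDerivAt_comp_polarMap_radius {v : (Fin 2 → ℝ) → ℝ} {r θ : ℝ}
    (hv : DifferentiableAt ℝ v (polarMap (r, θ))) :
    HasDerivAt (fun s => v (polarMap (s, θ)))
      (Real.cos θ * partialDeriv 0 v (polarMap (r, θ)) +
        Real.sin θ * partialDeriv 1 v (polarMap (r, θ))) r := by
  have hpm : HasDerivAt (fun s => polarMap (s, θ)) ![Real.cos θ, Real.sin θ] r := by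
    rw [hasDerivAt_pi]
    intro i
    fin_cases i
    · simpa [polarMap] using! (hasDerivAt_id r).mul_const (Real.cos θ)
    · simpa [polarMap] using! (hasDerivAt_id r).mul_const (Real.sin θ)
  have := HasFDerivAt.comp_hasDerivAt (f := fun s => polarMap (s, θ)) r hv.hasFDerivAt hpm
  rw [fderiv_apply_eq] at this
  exact this

lemma analyticOnNhd_partialDeriv {v : (Fin 2 → ℝ) → ℝ} {s : Set (Fin 2 → ℝ)}
    (hv : AnalyticOnNhd ℝ v s) (i : Fin 2) : AnalyticOnNhd ℝ (partialDeriv i v) s := fun x hx =>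
  ((ContinuousLinearMap.apply ℝ ℝ (Pi.single i (1 : ℝ) : Fin 2 → ℝ)).analyticAt _).comp
    (hv.fderiv x hx)

lemma hessian_symm {v : (Fin 2 → ℝ) → ℝ} {x : Fin 2 → ℝ} (hv : AnalyticAt ℝ v x) (i j : Fin 2) :
    hessian v x i j = hessian v x j i := by
  have hsymm := (hv.contDiffAt (n := ω)).isSymmSndFDerivAt (by simp)
  have hd : DifferentiableAt ℝ (fderiv ℝ v) x := hv.fderiv.differentiableAt
  have key (i j : Fin 2) : hessian v x i j =
      fderiv ℝ (fderiv ℝ v) x (Pi.single i 1) (Pi.single j 1) := by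
    have h := (ContinuousLinearMap.apply ℝ ℝ
      (Pi.single j (1 : ℝ) : Fin 2 → ℝ)).hasFDerivAt.comp x hd.hasFDerivAt
    change fderiv ℝ (partialDeriv j v) x (Pi.single i 1) = _
    have e : partialDeriv j v = (ContinuousLinearMap.apply ℝ ℝ
      (Pi.single j (1 : ℝ) : Fin 2 → ℝ)) ∘ fderiv ℝ v := rfl
    rw [e, h.fderiv]
    rfl
  rw [key, key, hsymm.eq]

lemma differentiableAt_w {ρ : ℝ × ℝ} (hρ : ρ ∈ D1) : DifferentiableAt ℝ w (polarMap ρ) :=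
  (analyticOnNhd_w _ (polarMap_mem_B1 hρ)).differentiableAt

lemma abs_lt_one_of_mem {r : ℝ} (hr : r ∈ Ioo (0 : ℝ) 1) : |r| < 1 := by
  rw [abs_of_pos hr.1]; exact hr.2

lemma Wr_eq_partialDeriv {r θ : ℝ} (h : (r, θ) ∈ D1) :
    Wr r θ = Real.cos θ * partialDeriv 0 w (polarMap (r, θ)) +
      Real.sin θ * partialDeriv 1 w (polarMap (r, θ)) := by
  refine (hasDerivAt_W_radius (abs_lt_one_of_mem h.1) θ).unique
    ((hasDerivAt_comp_polarMap_radius (differentiableAt_w h)).congr_of_eventuallyEq ?_)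
  filter_upwards [Ioo_mem_nhds h.1.1 h.1.2] with s hs
  exact (W_eq_w_polarMap hs.1 h.2).symm

lemma Wt_eq_partialDeriv {r θ : ℝ} (h : (r, θ) ∈ D1) :
    Wt r θ = -(r * Real.sin θ) * partialDeriv 0 w (polarMap (r, θ)) +
      r * Real.cos θ * partialDeriv 1 w (polarMap (r, θ)) := by
  refine (hasDerivAt_W_angle (abs_lt_one_of_mem h.1) θ).unique
    ((hasDerivAt_comp_polarMap_angle (differentiableAt_w h)).congr_of_eventuallyEq ?_)
  filter_upwards [Ioo_mem_nhds h.2.1 h.2.2] with s hs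
  exact (W_eq_w_polarMap h.1.1 hs).symm

/-- The Hessian form of `w` vanishes on tangent vectors of circles (because of
`W_θθ + r W_r = 0`), and its mixed entry in the polar frame is `r W_rθ - W_θ`. -/
lemma hessian_w_polar {r θ : ℝ} (h : (r, θ) ∈ D1) {p : Fin 2 → ℝ} (hp : p = polarMap (r, θ)) :
    p 0 ^ 2 * hessian w p 1 1 - 2 * p 0 * p 1 * hessian w p 0 1 + p 1 ^ 2 * hessian w p 0 0 = 0 ∧
    r * Wrt r θ - Wt r θ = p 0 * p 1 * (hessian w p 1 1 - hessian w p 0 0) +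
      (p 0 ^ 2 - p 1 ^ 2) * hessian w p 0 1 := by
  have hB := polarMap_mem_B1 h
  have hsymm := hessian_symm (analyticOnNhd_w _ hB) 1 0
  have hd (i : Fin 2) : HasDerivAt (fun s => partialDeriv i w (polarMap (r, s)))
      (-(r * Real.sin θ) * hessian w (polarMap (r, θ)) 0 i +
        r * Real.cos θ * hessian w (polarMap (r, θ)) 1 i) θ :=
    hasDerivAt_comp_polarMap_angle
      (analyticOnNhd_partialDeriv analyticOnNhd_w i _ hB).differentiableAt
  have hev : ∀ᶠ s in 𝓝 θ, (r, s) ∈ D1 := by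
    filter_upwards [Ioo_mem_nhds h.2.1 h.2.2] with s hs using ⟨h.1, hs⟩
  have h1 := (hasDerivAt_Wt_angle (abs_lt_one_of_mem h.1) θ).unique
    (((((Real.hasDerivAt_sin θ).const_mul r).neg.mul (hd 0)).add
      (((Real.hasDerivAt_cos θ).const_mul r).mul (hd 1))).congr_of_eventuallyEq
      (hev.mono fun s hs => Wt_eq_partialDeriv hs))
  have h2 := (hasDerivAt_Wr_angle (abs_lt_one_of_mem h.1) θ).unique
    ((((Real.hasDerivAt_cos θ).mul (hd 0)).add
      ((Real.hasDerivAt_sin θ).mul (hd 1))).congr_of_eventuallyEq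
      (hev.mono fun s hs => Wr_eq_partialDeriv hs))
  have h3 := Wr_eq_partialDeriv h
  have h4 := Wt_eq_partialDeriv h
  have e0 : p 0 = r * Real.cos θ := by rw [hp]; rfl
  have e1 : p 1 = r * Real.sin θ := by rw [hp]; rfl
  rw [e0, e1, hp]
  simp only [Pi.neg_apply] at h1
  rw [hsymm] at h1 h2
  constructor
  · linear_combination -h1 - r * h3
  · linear_combination r * h2 - h4

lemma hodograph_equation {p : Fin 2 → ℝ} (hp : p ∈ B1) :
    p 0 ^ 2 * hessian w p 1 1 - 2 * p 0 * p 1 * hessian w p 0 1 + p 1 ^ 2 * hessian w p 0 0 =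
      0 := by
  obtain ⟨⟨r, θ⟩, h, e⟩ := exists_polarMap_eq hp
  exact (hessian_w_polar h e.symm).1

lemma det_hessian_w_ne_zero {p : Fin 2 → ℝ} (hp : p ∈ B1) (hne : p 0 ≠ p 1) :
    (hessian w p).det ≠ 0 := by
  obtain ⟨⟨r, θ⟩, h, e⟩ := exists_polarMap_eq hp
  obtain ⟨h1, h2⟩ := hessian_w_polar h e.symm
  have hθ : θ ≠ Real.pi / 4 := by
    rintro rfl
    apply hne
    rw [← e]
    simp [polarMap]
  have hne0 := mul_Wrt_sub_Wt_ne_zero h.1 h.2 hθ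
  rw [h2] at hne0
  have hsymm := hessian_symm (analyticOnNhd_w _ hp) 1 0
  intro hdet
  rw [Matrix.det_fin_two, hsymm] at hdet
  -- the determinant in the orthogonal basis `(p, q)`, `(-q, p)`
  have key : (p 0 * p 1 * (hessian w p 1 1 - hessian w p 0 0) +
      (p 0 ^ 2 - p 1 ^ 2) * hessian w p 0 1) ^ 2 = 0 := by
    linear_combination (p 0 ^ 2 * hessian w p 0 0 + 2 * p 0 * p 1 * hessian w p 0 1 +
      p 1 ^ 2 * hessian w p 1 1) * h1 - (p 0 ^ 2 + p 1 ^ 2) ^ 2 * hdet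
  exact hne0 (sq_eq_zero_iff.1 key)

/-! ### The map `g` inverts the gradient of `w` -/

lemma isCritical_iff_grad {x : Fin 2 → ℝ} {ρ : ℝ × ℝ} (hρ : ρ ∈ D1) :
    IsCritical x ρ ↔ grad w (polarMap ρ) = x := by
  obtain ⟨r, θ⟩ := ρ
  have h1 := Wr_eq_partialDeriv hρ
  have h2 := Wt_eq_partialDeriv hρ
  have hcs := Real.sin_sq_add_cos_sq θ
  constructor
  · rintro ⟨-, e1, e2⟩
    simp only at e1 e2
    rw [h1] at e1
    have e3 : x 1 * Real.cos θ - x 0 * Real.sin θ =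
        -Real.sin θ * partialDeriv 0 w (polarMap (r, θ)) +
          Real.cos θ * partialDeriv 1 w (polarMap (r, θ)) := by
      have hr : r ≠ 0 := hρ.1.1.ne'
      refine mul_left_cancel₀ hr ?_
      rw [e2, h2]
      ring
    ext i
    fin_cases i
    · simp only [grad, Fin.zero_eta]
      linear_combination -Real.cos θ * e1 + Real.sin θ * e3 +
        (x 0 - partialDeriv 0 w (polarMap (r, θ))) * hcs
    · simp only [grad, Fin.mk_one]
      linear_combination -Real.sin θ * e1 - Real.cos θ * e3 +
        (x 1 - partialDeriv 1 w (polarMap (r, θ))) * hcs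
  · rintro rfl
    refine ⟨hρ, ?_, ?_⟩
    · simp only [grad]
      rw [h1]
      ring
    · simp only [grad]
      rw [h2]
      ring

lemma g_mem_B1 {x : Fin 2 → ℝ} (hx : x ∈ Omega1) : g x ∈ B1 :=
  polarMap_mem_B1 (isCritical_minimaxPoint hx).1

lemma grad_w_g {x : Fin 2 → ℝ} (hx : x ∈ Omega1) : grad w (g x) = x :=
  (isCritical_iff_grad (isCritical_minimaxPoint hx).1).1 (isCritical_minimaxPoint hx)

lemma eq_g_of_grad_eq {x p : Fin 2 → ℝ} (hx : x ∈ Omega1) (hp : p ∈ B1) (h : grad w p = x) :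
    p = g x := by
  obtain ⟨ρ, hρ, rfl⟩ := exists_polarMap_eq hp
  rw [((isCritical_iff_grad hρ).2 h).unique hx (isCritical_minimaxPoint hx)]
  rfl

/-- Off the diagonal the minimax point does not lie on the ray `θ = π / 4`, where `W_θ = 0`. -/
lemma g_zero_ne_g_one {x : Fin 2 → ℝ} (hx : x ∈ Omega1 \ diagonal) : g x 0 ≠ g x 1 := by
  obtain ⟨⟨hr, hθ⟩, -, h2⟩ := isCritical_minimaxPoint hx.1
  set ρ := minimaxPoint x with hρ
  intro h
  have hcs : Real.cos ρ.2 = Real.sin ρ.2 := mul_left_cancel₀ hr.1.ne' h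
  have hθ4 : ρ.2 = Real.pi / 4 := by
    have hpi := Real.pi_pos
    rw [← Real.sin_pi_div_two_sub] at hcs
    have := Real.injOn_sin ⟨by linarith [hθ.2], by linarith [hθ.1]⟩
      ⟨by linarith [hθ.1], hθ.2.le⟩ hcs
    linarith
  have hW : Wt ρ.1 ρ.2 = 0 := by rw [hθ4]; exact trigSeries_pi_div_four _ _ _
  rw [hW, ← hcs, ← sub_mul] at h2
  have h3 : x 1 = x 0 := by
    have hc := (cos_pos_of_mem hθ).ne'
    have := (mul_eq_zero.1 h2).resolve_left hr.1.ne'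
    exact sub_eq_zero.1 ((mul_eq_zero.1 this).resolve_right hc)
  refine hx.2 ⟨x 0, ⟨hx.1.1.le, hx.1.2.1.le⟩, ?_⟩
  ext i
  fin_cases i
  · rfl
  · exact h3

lemma isOpen_Omega1 : IsOpen Omega1 :=
  (isOpen_lt continuous_const (continuous_apply 0)).inter
    ((isOpen_lt (continuous_apply 0) continuous_const).inter
      ((isOpen_lt continuous_const (continuous_apply 1)).inter
        (isOpen_lt (continuous_apply 1) continuous_const)))

lemma isClosed_diagonal : IsClosed diagonal := by
  have : diagonal = (fun t : ℝ => (![t, t] : Fin 2 → ℝ)) '' Icc 0 1 := by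
    ext x
    simp only [diagonal, mem_image, mem_ofPred_eq, eq_comm]
  rw [this]
  exact (isCompact_Icc.image (by fun_prop)).isClosed

lemma isOpen_Omega1_diff_diagonal : IsOpen (Omega1 \ diagonal) :=
  isOpen_Omega1.sdiff isClosed_diagonal

lemma analyticOnNhd_grad_w : AnalyticOnNhd ℝ (grad w) B1 := fun p hp =>
  AnalyticAt.pi fun i => analyticOnNhd_partialDeriv analyticOnNhd_w i p hp

lemma fderiv_grad_apply {v : (Fin 2 → ℝ) → ℝ} {p : Fin 2 → ℝ} (hv : AnalyticAt ℝ v p)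
    (y : Fin 2 → ℝ) (i : Fin 2) :
    fderiv ℝ (grad v) p y i = y 0 * hessian v p 0 i + y 1 * hessian v p 1 i := by
  have hd (i : Fin 2) : DifferentiableAt ℝ (partialDeriv i v) p :=
    (((ContinuousLinearMap.apply ℝ ℝ (Pi.single i (1 : ℝ) : Fin 2 → ℝ)).analyticAt _).comp
      hv.fderiv).differentiableAt
  have : fderiv ℝ (grad v) p = ContinuousLinearMap.pi fun i => fderiv ℝ (partialDeriv i v) p :=
    (hasFDerivAt_pi.2 fun i => (hd i).hasFDerivAt).fderiv
  rw [this, ContinuousLinearMap.pi_apply]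
  exact fderiv_apply_eq _ _ _

/-- Analyticity of `g` off the diagonal, by the inverse function theorem: the local inverse of `∇w`
takes its values in critical points, hence coincides with `g`. -/
lemma analyticOnNhd_g : AnalyticOnNhd ℝ g (Omega1 \ diagonal) := by
  intro x hx
  have hp := g_mem_B1 hx.1
  have hw := analyticOnNhd_w _ hp
  have hG := analyticOnNhd_grad_w _ hp
  set L := fderiv ℝ (grad w) (g x) with hL
  have hinj : Function.Injective L := by
    rw [injective_iff_map_eq_zero]
    intro v hv
    refine Matrix.eq_zero_of_vecMul_eq_zero (det_hessian_w_ne_zero hp (g_zero_ne_g_one hx)) ?_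
    ext i
    have := congrFun hv i
    rw [hL, fderiv_grad_apply hw] at this
    simpa [Matrix.vecMul, dotProduct, Fin.sum_univ_two] using this
  set e : (Fin 2 → ℝ) ≃L[ℝ] (Fin 2 → ℝ) :=
    (LinearEquiv.ofInjectiveEndo L.toLinearMap hinj).toContinuousLinearEquiv with he
  have heL : (e : (Fin 2 → ℝ) →L[ℝ] (Fin 2 → ℝ)) = L := by
    ext v : 1
    rfl
  have hderiv : HasFDerivAt (grad w) (e : (Fin 2 → ℝ) →L[ℝ] (Fin 2 → ℝ)) (g x) := by
    rw [heL]
    exact hG.differentiableAt.hasFDerivAt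
  have hC : ContDiffAt ℝ ω (grad w) (g x) := hG.contDiffAt
  have hω : (ω : WithTop ℕ∞) ≠ 0 := by simp
  set φ := hC.localInverse hderiv hω with hφ
  have h1 : ContDiffAt ℝ ω φ x := by
    have := hC.to_localInverse hderiv hω
    rwa [grad_w_g hx.1] at this
  have h2 : φ x = g x := by
    have := hC.localInverse_apply_image hderiv hω
    rwa [grad_w_g hx.1] at this
  have h3 : ∀ᶠ y in 𝓝 x, grad w (φ y) = y := by
    have := (hC.hasStrictFDerivAt' hderiv hω).eventually_right_inverse
    rwa [grad_w_g hx.1] at this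
  have h4 : ∀ᶠ y in 𝓝 x, φ y ∈ B1 :=
    h1.continuousAt.eventually (by rw [h2]; exact isOpen_B1.mem_nhds hp)
  refine h1.analyticAt.congr ?_
  filter_upwards [h3, h4, isOpen_Omega1.mem_nhds hx.1] with y e1 e2 e3
  exact eq_g_of_grad_eq e3 e2 e1

/-! ### The function `u` -/

lemma u_eq {x : Fin 2 → ℝ} (hx : x ∈ Omega1) : u x = x ⬝ᵥ g x - w (g x) := by
  have hD := (isCritical_minimaxPoint hx).1
  rw [u_eq_objective, objective, g, W_eq_w_polarMap hD.1.1 hD.2]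
  simp only [dotProduct, Fin.sum_univ_two, polarMap, Matrix.cons_val_zero, Matrix.cons_val_one]
  ring

lemma hasFDerivAt_u {x : Fin 2 → ℝ} (hx : x ∈ Omega1 \ diagonal) :
    HasFDerivAt u (∑ i, g x i • ContinuousLinearMap.proj (R := ℝ) (φ := fun _ : Fin 2 => ℝ) i)
      x := by
  have hg : HasFDerivAt g (fderiv ℝ g x) x := (analyticOnNhd_g x hx).differentiableAt.hasFDerivAt
  have hgi (i : Fin 2) : HasFDerivAt (fun y => g y i)
      ((ContinuousLinearMap.proj (R := ℝ) (φ := fun _ : Fin 2 => ℝ) i).comp (fderiv ℝ g x)) x :=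
    hasFDerivAt_pi'.1 hg i
  have hw : HasFDerivAt w (fderiv ℝ w (g x)) (g x) :=
    (analyticOnNhd_w _ (g_mem_B1 hx.1)).differentiableAt.hasFDerivAt
  have hproj (i : Fin 2) : HasFDerivAt (fun y : Fin 2 → ℝ => y i)
      (ContinuousLinearMap.proj (R := ℝ) (φ := fun _ : Fin 2 => ℝ) i) x := hasFDerivAt_apply i x
  have h := (((hproj 0).mul (hgi 0)).add ((hproj 1).mul (hgi 1))).sub (hw.comp x hg)
  have e : u =ᶠ[𝓝 x] fun y => y 0 * g y 0 + y 1 * g y 1 - w (g y) := by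
    filter_upwards [isOpen_Omega1.mem_nhds hx.1] with y hy
    rw [u_eq hy, dotProduct, Fin.sum_univ_two]
  refine HasFDerivAt.congr_of_eventuallyEq ?_ e
  convert! h using 1
  ext1 v
  have hgrad := grad_w_g hx.1
  have h0 : partialDeriv 0 w (g x) = x 0 := congrFun hgrad 0
  have h1 : partialDeriv 1 w (g x) = x 1 := congrFun hgrad 1
  simp only [Fin.sum_univ_two, add_apply, sub_apply, smul_apply, ContinuousLinearMap.comp_apply,
    ContinuousLinearMap.proj_apply, smul_eq_mul, fderiv_apply_eq, h0, h1]
  ring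

lemma grad_u {x : Fin 2 → ℝ} (hx : x ∈ Omega1 \ diagonal) : grad u x = g x := by
  ext i
  rw [grad, partialDeriv, (hasFDerivAt_u hx).fderiv]
  simp [Fin.sum_univ_two]
  fin_cases i <;> simp

lemma analyticOnNhd_u : AnalyticOnNhd ℝ u (Omega1 \ diagonal) := by
  intro x hx
  have hg := analyticOnNhd_g x hx
  have hgi (i : Fin 2) : AnalyticAt ℝ (fun y => g y i) x := analyticAt_pi_iff.1 hg i
  have hproj (i : Fin 2) : AnalyticAt ℝ (fun y : Fin 2 → ℝ => y i) x :=
    (ContinuousLinearMap.proj (R := ℝ) (φ := fun _ : Fin 2 => ℝ) i).analyticAt x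
  have hw := (analyticOnNhd_w _ (g_mem_B1 hx.1)).comp hg
  refine ((((hproj 0).mul (hgi 0)).add ((hproj 1).mul (hgi 1))).sub hw).congr ?_
  filter_upwards [isOpen_Omega1.mem_nhds hx.1] with y hy
  rw [u_eq hy, dotProduct, Fin.sum_univ_two]
  rfl

/-- With `H` the Hessian matrix of `w` at `g x`, the Hessian matrix of `u` at `x` is `H⁻¹`. Thus
`Δ_∞ u = g H⁻¹ gᵀ`, and `det H` times this number is the left-hand side of the hodograph
equation. -/
lemma infLaplacian_u_eq_zero {x : Fin 2 → ℝ} (hx : x ∈ Omega1 \ diagonal) :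
    infLaplacian u x = 0 := by
  have hp := g_mem_B1 hx.1
  have hw := analyticOnNhd_w _ hp
  have hg : HasFDerivAt g (fderiv ℝ g x) x := (analyticOnNhd_g x hx).differentiableAt.hasFDerivAt
  set v := fderiv ℝ g x (g x) with hv
  have hhess (i j : Fin 2) : hessian u x i j = fderiv ℝ g x (Pi.single i 1) j := by
    have e : partialDeriv j u =ᶠ[𝓝 x] fun y => g y j := by
      filter_upwards [isOpen_Omega1_diff_diagonal.mem_nhds hx] with y hy
      exact congrFun (grad_u hy) j
    change fderiv ℝ (partialDeriv j u) x (Pi.single i 1) = _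
    rw [e.fderiv_eq, (hasFDerivAt_pi'.1 hg j).fderiv]
    rfl
  have hlap : infLaplacian u x = v 0 * g x 0 + v 1 * g x 1 := by
    have hvj (j : Fin 2) : v j = g x 0 * hessian u x 0 j + g x 1 * hessian u x 1 j := by
      rw [hhess, hhess]
      exact clm_apply_eq
        ((ContinuousLinearMap.proj (R := ℝ) (φ := fun _ : Fin 2 => ℝ) j).comp (fderiv ℝ g x)) (g x)
    rw [infLaplacian, grad_u hx, hvj, hvj]
    simp only [dotProduct, Matrix.mulVec, Fin.sum_univ_two]
    ring
  -- differentiate `∇w (g x) = x` in the direction `g x`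
  have hinv (i : Fin 2) :
      v 0 * hessian w (g x) 0 i + v 1 * hessian w (g x) 1 i = g x i := by
    have h1 := (analyticOnNhd_grad_w _ hp).differentiableAt.hasFDerivAt.comp x hg
    have h2 : grad w ∘ g =ᶠ[𝓝 x] id := by
      filter_upwards [isOpen_Omega1.mem_nhds hx.1] with y hy using grad_w_g hy
    have h3 := h1.unique ((hasFDerivAt_id x).congr_of_eventuallyEq h2)
    have h4 := congrArg (fun L : (Fin 2 → ℝ) →L[ℝ] (Fin 2 → ℝ) => L (g x) i) h3
    simp only [ContinuousLinearMap.comp_apply, ContinuousLinearMap.id_apply] at h4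
    rwa [fderiv_grad_apply hw] at h4
  have hdet := det_hessian_w_ne_zero hp (g_zero_ne_g_one hx)
  have hpde := hodograph_equation hp
  have hsymm := hessian_symm hw 1 0
  have i0 := hinv 0
  have i1 := hinv 1
  rw [Matrix.det_fin_two] at hdet
  rw [hsymm] at hdet i0
  rw [hlap]
  refine mul_left_cancel₀ hdet ?_
  linear_combination hpde + (hessian w (g x) 1 1 * g x 0 - hessian w (g x) 0 1 * g x 1) * i0 +
    (hessian w (g x) 0 0 * g x 1 - hessian w (g x) 0 1 * g x 0) * i1

end

end InfinityPotential

theorem mainTheorem6 :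
    -- every point of the open square has exactly one minimax point, and it is interior,
    -- so that `g` is well defined
    (∀ x ∈ Omega1, IsMinimax x (minimaxPoint x) ∧ minimaxPoint x ∈ D1 ∧
      ∀ ρ : ℝ × ℝ, IsMinimax x ρ → ρ = minimaxPoint x) ∧
    -- the formula of `u` in terms of `g`
    (∀ x ∈ Omega1, g x ∈ B1 ∧ u x = x ⬝ᵥ g x - w (g x)) ∧
    -- `g` and `u` are real-analytic off the diagonal
    AnalyticOnNhd ℝ g (Omega1 \ diagonal) ∧
    AnalyticOnNhd ℝ u (Omega1 \ diagonal) ∧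
    -- `u` is infinity-harmonic in the classical sense off the diagonal
    (∀ x ∈ Omega1 \ diagonal, infLaplacian u x = 0) ∧
    -- `w` is real-analytic, its Hessian matrix is nonsingular off the ray `θ = π/4`,
    -- and it solves the linear hodograph equation
    AnalyticOnNhd ℝ w B1 ∧
    (∀ p ∈ B1, p 0 ≠ p 1 → (hessian w p).det ≠ 0) ∧
    (∀ p ∈ B1, p 0 ^ 2 * hessian w p 1 1 - 2 * p 0 * p 1 * hessian w p 0 1
      + p 1 ^ 2 * hessian w p 0 0 = 0) :=
  ⟨fun x hx => ⟨InfinityPotential.isMinimax_minimaxPoint x,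
      (InfinityPotential.isCritical_minimaxPoint hx).1, fun _ h => h.eq_minimaxPoint hx⟩,
    fun _ hx => ⟨InfinityPotential.g_mem_B1 hx, InfinityPotential.u_eq hx⟩,
    InfinityPotential.analyticOnNhd_g, InfinityPotential.analyticOnNhd_u,
    fun _ hx => InfinityPotential.infLaplacian_u_eq_zero hx,
    InfinityPotential.analyticOnNhd_w,
    fun _ hp hne => InfinityPotential.det_hessian_w_ne_zero hp hne,
    fun _ hp => InfinityPotential.hodograph_equation hp⟩
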